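/- Let $G(x)=\tfrac12 e^{-|x|}$. Consider the modified Camassa–Holm equation $$m_t+[(u^2-u_x^2)m]_x=0,\qquad m=u-u_{xx},\quad u=G*m,\qquad x\in\mathbb R,\ t>0,\qquad m(\cdot,0)=m_0,$$ where $m_0\in C^1(\mathbb R)$ has support in $(-L,L)$, $L>0$. Put $M_1=\|m_0\|_{L^1}$ and $u_0=G*m_0$. A classical solution on $\mathbb R\times[0,T)$, $0<T\le\infty$, is a pair $(u,m)$ satisfying this initial value problem such that $u,u_x,u_{xx},u_{xxx},u_t$ and $m,m_x,m_t$ exist and are continuous on $\mathbb R\times[0,T)$ and $m$ is bounded on $\mathbb R\times[0,T']$ for every $T'<T$. Let $T_{max}$ be the supremum of all $T$ for which a classical solution on $\mathbb R\times[0,T)$ exists, and let $(u,m)$ be the classical solution on $\mathbb R\times[0,T_{max})$. Let $X$, with $X,X_\xi,X_{\xi\xi},X_t$ continuous on $[-L,L]\times[0,T_{max})$, be the solution of the Lagrange dynamics $X(\xi,0)=\xi$, $$X_t(\xi,t)=\Big(\int_{-L}^{L}G(X(\xi,t)-X(\theta,t))m_0(\theta)\,d\theta\Big)^2-\Big(\int_{-L}^{L}G'(X(\xi,t)-X(\theta,t))m_0(\theta)\,d\theta\Big)^2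 .$$ (a) Suppose that some $\xi_0\in[-L,L]$ satisfies $m_0(\xi_0)>0$ and $-\partial_xu_0(\xi_0)>\sqrt{M_1^3/(2m_0(\xi_0))}$. Then $m$ blows up at the time $T_{max}$, that is, $\limsup_{t\to T_{max}}\|m(\cdot,t)\|_{L^\infty}=+\infty$, and $$0<T_{max}\le t^*:=\frac{2}{M_1^3}\Big(-\partial_xu_0(\xi_0)-\sqrt{[\partial_xu_0(\xi_0)]^2-\tfrac{M_1^3}{2m_0(\xi_0)}}\Big).$$ Moreover, if $T_{max}=t^*$, then for all $t\in[0,T_{max})$ $$\|m(\cdot,t)\|_{L^\infty}\ge\frac1{C(T_{max}-t)},\qquad \inf_{\xi\in(-L,L)}X_\xi(\xi,t)\le C\,m_0(\xi_0)(T_{max}-t),$$ where $C=-\partial_xu_0(\xi_0)+\sqrt{[\partial_xu_0(\xi_0)]^2-\tfrac{M_1^3}{2m_0(\xi_0)}}$. (b) Suppose that some $\xi_1\in[-L,L]$ satisfies $m_0(\xi_1)<0$ and $\partial_xu_0(\xi_1)>\sqrt{M_1^3/(-2m_0(\xi_1))}$. Then $m$ blows up at the time $T_{max}$, that is, $\limsup_{t\to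 T_{max}}\|m(\cdot,t)\|_{L^\infty}=+\infty$, and $$0<T_{max}\le t^*:=\frac{2}{M_1^3}\Big(\partial_xu_0(\xi_1)-\sqrt{[\partial_xu_0(\xi_1)]^2+\tfrac{M_1^3}{2m_0(\xi_1)}}\Big).$$ Moreover, if $T_{max}=t^*$, then for all $t\in[0,T_{max})$ $$\|m(\cdot,t)\|_{L^\infty}\ge\frac1{C(T_{max}-t)},\qquad \inf_{\xi\in(-L,L)}X_\xi(\xi,t)\le C\,m_0(\xi_1)(t-T_{max}),$$ where $C=\partial_xu_0(\xi_1)+\sqrt{[\partial_xu_0(\xi_1)]^2+\tfrac{M_1^3}{2m_0(\xi_1)}}$. -/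

import Mathlib

open Set Filter Topology MeasureTheory
open scoped ENNReal

noncomputable section

namespace MCH

/-- The fundamental solution `G(x) = e^{-|x|} / 2` of the Helmholtz operator `1 - ∂ₓₓ`. -/
def G (x : ℝ) : ℝ := Real.exp (-|x|) / 2

/-- The (weak) derivative `G'(x) = -sgn(x) e^{-|x|} / 2`, with the convention `G'(0) = 0`. -/
def G' (x : ℝ) : ℝ := -(SignType.sign x : ℝ) * Real.exp (-|x|) / 2

/-- The convolution `(G ∗ m)(x) = ∫ G(x - y) m(y) dy` on the line. -/
def convG (m : ℝ → ℝ) (x : ℝ) : ℝ := ∫ y, G (x - y) * m y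

/-- The time interval `[0, T)`, where `T` may be `+∞`. -/
def timeInterval (T : ℝ≥0∞) : Set ℝ := {t | 0 ≤ t ∧ ENNReal.ofReal t < T}

/-- The space `C^k_n(S × I)` of functions `f(x, t)` on `S × I` whose space derivatives up to order
`k` and whose time derivatives up to order `n` exist and are jointly continuous on `S × I`
(derivatives are one-sided at end points of `S` and `I`). -/
structure IsCkn (k n : ℕ) (S I : Set ℝ) (f : ℝ → ℝ → ℝ) : Prop where
  contDiffOn_space : ∀ t ∈ I, ContDiffOn ℝ k (fun x => f x t) S
  contDiffOn_time : ∀ x ∈ S, ContDiffOn ℝ n (fun t => f x t) I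
  continuousOn_space : ∀ j ≤ k,
    ContinuousOn (fun p : ℝ × ℝ => iteratedDerivWithin j (fun x => f x p.2) S p.1) (S ×ˢ I)
  continuousOn_time : ∀ j ≤ n,
    ContinuousOn (fun p : ℝ × ℝ => iteratedDerivWithin j (fun t => f p.1 t) I p.2) (S ×ˢ I)

/-- `(u, m)` is a classical solution on `ℝ × [0, T)` of the modified Camassa–Holm equation
`m_t + [(u² - u_x²) m]_x = 0`, `m = u - u_xx = (1 - ∂ₓₓ) u`, `u = G ∗ m`, with `m(·, 0) = m₀`.
As usual for solutions on the whole line, `m` is required to be bounded on every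
strip `ℝ × [0, T']` with `T' < T`. -/
structure IsClassicalSolution (m₀ : ℝ → ℝ) (T : ℝ≥0∞) (u m : ℝ → ℝ → ℝ) : Prop where
  regular_u : IsCkn 3 1 univ (timeInterval T) u
  regular_m : IsCkn 1 1 univ (timeInterval T) m
  bounded : ∀ T' ∈ timeInterval T, ∃ K : ℝ, ∀ t ∈ Icc 0 T', ∀ x, |m x t| ≤ K
  helmholtz : ∀ t ∈ timeInterval T, ∀ x, m x t = u x t - iteratedDeriv 2 (fun y => u y t) x
  conv : ∀ t ∈ timeInterval T, ∀ x, u x t = convG (fun y => m y t) x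
  equation : ∀ t ∈ timeInterval T, ∀ x,
    derivWithin (fun s => m x s) (timeInterval T) t
      + deriv (fun y => (u y t ^ 2 - deriv (fun z => u z t) y ^ 2) * m y t) x = 0
  initial : 0 < T → ∀ x, m x 0 = m₀ x

/-- The maximal existence time (possibly `+∞`) of the classical solution starting from `m₀`: the
supremum of all `T` such that a classical solution exists on `ℝ × [0, T)`. -/
def maxTime (m₀ : ℝ → ℝ) : ℝ≥0∞ := sSup {T | ∃ u m, IsClassicalSolution m₀ T u m}

/-- The velocity field `U(x, t)` generated by `X`, namely
`(∫ G(x - X(θ, t)) m₀(θ) dθ)² - (∫ G'(x - X(θ, t)) m₀(θ) dθ)²`, integrals over `[-L, L]`. -/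
def velocity (L : ℝ) (m₀ : ℝ → ℝ) (X : ℝ → ℝ → ℝ) (x t : ℝ) : ℝ :=
  (∫ θ in (-L)..L, G (x - X θ t) * m₀ θ) ^ 2 - (∫ θ in (-L)..L, G' (x - X θ t) * m₀ θ) ^ 2

/-- `X ∈ C^2_1([-L, L] × [0, T))` solves the Lagrange dynamics
`∂ₜ X(ξ, t) = U(X(ξ, t), t)`, `X(ξ, 0) = ξ`. -/
structure IsLagrangeSolution (L : ℝ) (m₀ : ℝ → ℝ) (T : ℝ≥0∞) (X : ℝ → ℝ → ℝ) : Prop where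
  regular : IsCkn 2 1 (Icc (-L) L) (timeInterval T) X
  equation : ∀ ξ ∈ Icc (-L) L, ∀ t ∈ timeInterval T,
    derivWithin (fun s => X ξ s) (timeInterval T) t = velocity L m₀ X (X ξ t) t
  initial : 0 < T → ∀ ξ ∈ Icc (-L) L, X ξ 0 = ξ

/-- The norm `‖m(·, t)‖_{L^∞(ℝ)}` as an extended nonnegative real. -/
def supNorm (m : ℝ → ℝ → ℝ) (t : ℝ) : ℝ≥0∞ := eLpNorm (fun x => m x t) ∞ volume

end MCH

end

/-!
The proof works in Lagrangian variables. Splitting the kernel `G` at its kink writes `u` and `uₓ`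
as combinations of the two exponential moments `∫_{y < x} e^y m dy` and `∫_{y > x} e^{-y} m dy`,
and the velocity `u² - uₓ²` is their product (`convG_sq_sub_convG'_sq`). For an increasing flow
the moments at the particle `ξ` are integrals over labels with limit `ξ`, so the Lagrange dynamics
becomes `X_t = (∫_{-L}^ξ e^X m₀) (∫_ξ^L e^{-X} m₀)`, which has no kink. Particles with label `±L`
rest, so positions stay in `[-L, L]` and `exp` may be replaced there by a bounded, globally
Lipschitz function `E`. The resulting flow `X` exists for all times (`exists_truncatedFlow`),
and differentiating in `ξ` gives the Jacobian `X_ξ = 1 + m₀ ∫ 2 uₓ`, with the integral over `[0, t]`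
along the particle path (`hasDerivAt_label`).

Positivity of this Jacobian governs classical solutions. While it is positive, the momentum
`m(X(ξ, t), t) = m₀(ξ) / X_ξ(ξ, t)` is a classical solution (`isClassicalSolution`). Conversely, the
characteristics of any classical solution are diffeomorphisms of the line along which `m Y_ξ = m₀`
(`exists_characteristics`), and they satisfy the same truncated equation; by uniqueness they
coincide with `X`, which hence has positive Jacobian (`jac_pos`). If `m` remained bounded near a
finite maximal time, `m X_ξ = m₀` would keep `X_ξ` positive at that time, hence shortly
afterwards, and the solution could be continued (`limsup_supNorm_eq_top`).

For increasing flows each moment, rescaled by `e^{∓X}`, is at most the mass of `|m₀|` on its side,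
so particles move at speed at most `M₁² / 4` and `2 uₓ` changes along them at a rate of at most
`M₁³` (`abs_deriv_slope2_le`). At a label with `a = |m₀|` and initial rate of compression `q` this
gives `X_ξ ≤ 1 - 2 a q t + a M₁³ t² / 2`, a quadratic whose first zero is `t*` and which factors as
`a (t* - t) (C - M₁³ t / 2)` (`jac_le`, `quadratic_factor`). A classical solution cannot exist beyond
`t*`, and if it exists up to `t*`, then `X_ξ ≤ C a (t* - t)` yields both rates. A given solution of
the Lagrange dynamics agrees with `X`, since a first time at which its own Jacobian vanished would
be a zero of the Jacobian of `X` (`eq_truncatedFlow`).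
-/

namespace MCH

/-! ### Ordinary differential equations and parametric integrals -/

/-- Global existence for a bounded, globally Lipschitz vector field in a Banach space: the local
solutions on the intervals `(t₀ - n - 1, t₀ + n + 1)` agree where they overlap. -/
theorem exists_global_solution {E : Type*} [NormedAddCommGroup E] [NormedSpace ℝ E]
    [CompleteSpace E] {v : ℝ → E → E} {K : NNReal} (hK : ∀ t, LipschitzWith K (v t))
    (hc : ∀ x, Continuous fun t => v t x) {B : ℝ} (hB : ∀ t x, ‖v t x‖ ≤ B) (t₀ : ℝ) (x₀ : E) :
    ∃ y : ℝ → E, y t₀ = x₀ ∧ ∀ t, HasDerivAt y (v t (y t)) t := by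
  have hB0 : 0 ≤ B := (norm_nonneg _).trans (hB t₀ x₀)
  have local_sol : ∀ n : ℕ, ∃ y : ℝ → E, y t₀ = x₀ ∧
      ∀ t ∈ Ioo (t₀ - (n + 1)) (t₀ + (n + 1)), HasDerivAt y (v t (y t)) t := by
    intro n
    have hn : (0 : ℝ) < n + 1 := by positivity
    have hmem : t₀ ∈ Icc (t₀ - (n + 1)) (t₀ + (n + 1)) := ⟨by linarith, by linarith⟩
    have hPL : IsPicardLindelof v (⟨t₀, hmem⟩ : Icc (t₀ - (n + 1 : ℝ)) (t₀ + (n + 1))) x₀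
        (B.toNNReal * (n + 1)) 0 B.toNNReal K :=
      { lipschitzOnWith := fun t _ => (hK t).lipschitzOnWith
        continuousOn := fun x _ => (hc x).continuousOn
        norm_le := fun t _ x _ => (hB t x).trans (Real.le_coe_toNNReal B)
        mul_max_le := by simp }
    obtain ⟨y, hy0, hy⟩ := hPL.exists_eq_forall_mem_Icc_hasDerivWithinAt₀
    exact ⟨y, hy0, fun t ht => (hy t (Ioo_subset_Icc_self ht)).hasDerivAt
      (Icc_mem_nhds ht.1 ht.2)⟩
  choose z hz0 hz using local_sol
  have coh : ∀ m n : ℕ, m ≤ n → EqOn (z m) (z n) (Ioo (t₀ - (m + 1)) (t₀ + (m + 1))) := by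
    intro m n hmn
    have hmn' : (m : ℝ) ≤ n := by exact_mod_cast hmn
    have hm : (0 : ℝ) < m + 1 := by positivity
    exact ODE_solution_unique_of_mem_Ioo (s := fun _ => univ) (K := K) (v := v) (t₀ := t₀)
      (fun t _ => (hK t).lipschitzOnWith) ⟨by linarith, by linarith⟩
      (fun t ht => ⟨hz m t ht, trivial⟩)
      (fun t ht => ⟨hz n t ⟨by linarith [ht.1], by linarith [ht.2]⟩, trivial⟩)
      ((hz0 m).trans (hz0 n).symm)
  have key : ∀ n : ℕ, ∀ t ∈ Ioo (t₀ - (n + 1)) (t₀ + (n + 1)), z ⌈|t - t₀|⌉₊ t = z n t := by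
    intro n t ht
    have h1 : |t - t₀| ≤ ⌈|t - t₀|⌉₊ := Nat.le_ceil _
    have h2 := abs_le.1 h1
    have ht' : t ∈ Ioo (t₀ - ((⌈|t - t₀|⌉₊ : ℝ) + 1)) (t₀ + ((⌈|t - t₀|⌉₊ : ℝ) + 1)) :=
      ⟨by linarith [h2.1], by linarith [h2.2]⟩
    rcases le_total ⌈|t - t₀|⌉₊ n with h | h
    · exact coh _ _ h ht'
    · exact (coh _ _ h ht).symm
  refine ⟨fun t => z ⌈|t - t₀|⌉₊ t, by simp [hz0], fun t => ?_⟩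
  have h1 : |t - t₀| ≤ ⌈|t - t₀|⌉₊ := Nat.le_ceil _
  have h2 := abs_le.1 h1
  have ht' : t ∈ Ioo (t₀ - ((⌈|t - t₀|⌉₊ : ℝ) + 1)) (t₀ + ((⌈|t - t₀|⌉₊ : ℝ) + 1)) :=
    ⟨by linarith [h2.1], by linarith [h2.2]⟩
  refine (hz _ t ht').congr_of_eventuallyEq ?_
  filter_upwards [Ioo_mem_nhds ht'.1 ht'.2] with s hs
  exact key _ s hs

theorem contDiff_one_of_partial_derivs {f f₁ f₂ : ℝ → ℝ → ℝ}
    (h₁ : ∀ x t, HasDerivAt (fun y => f y t) (f₁ x t) x)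
    (h₂ : ∀ x t, HasDerivAt (fun s => f x s) (f₂ x t) t)
    (c₁ : Continuous fun p : ℝ × ℝ => f₁ p.1 p.2) (c₂ : Continuous fun p : ℝ × ℝ => f₂ p.1 p.2) :
    ContDiff ℝ 1 fun p : ℝ × ℝ => f p.1 p.2 := by
  have key : ∀ p : ℝ × ℝ, HasStrictFDerivAt (fun p : ℝ × ℝ => f p.1 p.2)
      ((ContinuousLinearMap.toSpanSingleton ℝ (f₁ p.1 p.2)).coprod
        (ContinuousLinearMap.toSpanSingleton ℝ (f₂ p.1 p.2))) p := by
    intro p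
    have := hasStrictFDerivAt_uncurry_coprod (𝕜 := ℝ) (u := p) (f := f)
      (f₁ := fun x t => ContinuousLinearMap.toSpanSingleton ℝ (f₁ x t))
      (f₂ := fun x t => ContinuousLinearMap.toSpanSingleton ℝ (f₂ x t))
      (Eventually.of_forall fun q => (h₁ q.1 q.2).hasFDerivAt)
      (Eventually.of_forall fun q => (h₂ q.1 q.2).hasFDerivAt)
      ((ContinuousLinearMap.toSpanSingletonCLE.continuous.comp c₁).continuousAt)
      ((ContinuousLinearMap.toSpanSingletonCLE.continuous.comp c₂).continuousAt)
    exact this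
  rw [contDiff_one_iff_hasFDerivAt]
  refine ⟨_, ?_, fun p => (key p).hasFDerivAt⟩
  have d1 := (ContinuousLinearMap.toSpanSingletonCLE (𝕜 := ℝ) (E := ℝ)).continuous.comp c₁
  have d2 := (ContinuousLinearMap.toSpanSingletonCLE (𝕜 := ℝ) (E := ℝ)).continuous.comp c₂
  have e := ((ContinuousLinearMap.compL ℝ (ℝ × ℝ) ℝ ℝ).flip
    (ContinuousLinearMap.fst ℝ ℝ ℝ)).continuous.comp d1
  have e' := ((ContinuousLinearMap.compL ℝ (ℝ × ℝ) ℝ ℝ).flip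
    (ContinuousLinearMap.snd ℝ ℝ ℝ)).continuous.comp d2
  refine (e.add e').congr fun p => ?_
  ext <;> simp

theorem hasDerivAt_integral_of_continuous {g g' : ℝ → ℝ → ℝ}
    (hg : Continuous fun p : ℝ × ℝ => g p.1 p.2) (hg' : Continuous fun p : ℝ × ℝ => g' p.1 p.2)
    (h : ∀ s θ, HasDerivAt (fun r => g r θ) (g' s θ) s) (a b s : ℝ) :
    HasDerivAt (fun r => ∫ θ in a..b, g r θ) (∫ θ in a..b, g' s θ) s := by
  have hcomp : IsCompact (Icc (s - 1) (s + 1) ×ˢ uIcc a b) := isCompact_Icc.prod isCompact_uIcc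
  obtain ⟨M, hM⟩ := hcomp.exists_bound_of_continuousOn hg'.continuousOn
  have cg : ∀ r, Continuous (g r) := fun r => hg.comp (by fun_prop : Continuous fun θ => (r, θ))
  have cg' : ∀ r, Continuous (g' r) := fun r => hg'.comp (by fun_prop : Continuous fun θ => (r, θ))
  refine (intervalIntegral.hasDerivAt_integral_of_dominated_loc_of_deriv_le
    (s := Icc (s - 1) (s + 1)) (bound := fun _ => M)
    (Icc_mem_nhds (by linarith) (by linarith))
    (Eventually.of_forall fun r => (cg r).aestronglyMeasurable)
    ((cg s).intervalIntegrable _ _) (cg' s).aestronglyMeasurable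
    (Eventually.of_forall fun θ hθ r hr => hM (r, θ) ⟨hr, uIoc_subset_uIcc hθ⟩)
    intervalIntegrable_const (Eventually.of_forall fun θ _ r _ => h r θ)).2

/-- A smooth, bounded, Lipschitz function which agrees with `exp` on `[-L, L]`. -/
theorem exists_truncated_exp {L : ℝ} (hL : 0 < L) : ∃ E : ℝ → ℝ, ContDiff ℝ 2 E ∧
    (∃ B, ∀ x, |E x| ≤ B) ∧ (∃ K, LipschitzWith K E) ∧ ∀ x ∈ Icc (-L) L, E x = Real.exp x := by
  let φ : ContDiffBump (0 : ℝ) := ⟨L, L + 1, hL, by linarith⟩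
  have hs : ContDiff ℝ 2 fun x => φ x * Real.exp x := φ.contDiff.mul Real.contDiff_exp
  have hcs : HasCompactSupport fun x => φ x * Real.exp x := φ.hasCompactSupport.mul_right
  refine ⟨fun x => φ x * Real.exp x, hs, ?_, hs.lipschitzWith_of_hasCompactSupport hcs two_ne_zero,
    fun x hx => ?_⟩
  · obtain ⟨B, hB⟩ := hcs.exists_bound_of_continuous hs.continuous
    exact ⟨B, fun x => by simpa using hB x⟩
  · have : φ x = 1 := φ.one_of_mem_closedBall (by
      rw [mem_closedBall_zero_iff, Real.norm_eq_abs]; exact abs_le.2 hx)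
    simp [this]

/-! ### The truncated Lagrange dynamics -/

/-- `E` is a bounded, Lipschitz, twice continuously differentiable substitute for the exponential
which agrees with it on `[-L, L]`. -/
structure IsTruncatedExp (L : ℝ) (E : ℝ → ℝ) : Prop where
  contDiff : ContDiff ℝ 2 E
  bounded : ∃ B, ∀ x, |E x| ≤ B
  lipschitz : ∃ K, LipschitzWith K E
  eq_exp : ∀ x ∈ Icc (-L) L, E x = Real.exp x

/-- The left exponential moment `∫_{-L}^ξ E(X(θ)) f(θ) dθ`; for `E = exp` it is the moment
`∫_{y < X(ξ)} e^y m(y) dy` of the momentum that `X` transports from `f`. -/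
noncomputable def leftMass (L : ℝ) (E f X : ℝ → ℝ) (ξ : ℝ) : ℝ := ∫ θ in (-L)..ξ, E (X θ) * f θ

/-- The right exponential moment `∫_ξ^L E(-X(θ)) f(θ) dθ`. -/
noncomputable def rightMass (L : ℝ) (E f X : ℝ → ℝ) (ξ : ℝ) : ℝ := ∫ θ in ξ..L, E (-X θ) * f θ

theorem abs_integral_mul_le {f g : ℝ → ℝ} (hf : Integrable f) {c : ℝ} (hc : 0 ≤ c)
    (hg : ∀ θ, f θ ≠ 0 → |g θ| ≤ c) (a b : ℝ) :
    |∫ θ in a..b, g θ * f θ| ≤ c * ∫ θ, |f θ| := by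
  have h1 : ∀ θ, ‖g θ * f θ‖ ≤ c * |f θ| := fun θ => by
    by_cases h : f θ = 0
    · simp [h]
    · rw [Real.norm_eq_abs, abs_mul]; gcongr; exact hg θ h
  have hi : Integrable fun θ => c * |f θ| := hf.abs.const_mul c
  calc |∫ θ in a..b, g θ * f θ| ≤ ∫ θ in uIoc a b, ‖g θ * f θ‖ :=
        (Real.norm_eq_abs _).symm.trans_le intervalIntegral.norm_integral_le_integral_norm_uIoc
    _ ≤ ∫ θ in uIoc a b, c * |f θ| :=
        integral_mono_of_nonneg (Eventually.of_forall fun _ => norm_nonneg _) hi.integrableOn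
          (Eventually.of_forall h1)
    _ ≤ ∫ θ, c * |f θ| :=
        setIntegral_le_integral hi (Eventually.of_forall fun θ => by positivity)
    _ = c * ∫ θ, |f θ| := integral_const_mul _ _

section Flux

variable {L : ℝ} {E f : ℝ → ℝ}

theorem abs_leftMass_le (hf : Integrable f) {B : ℝ} (hB : ∀ x, |E x| ≤ B) (X : ℝ → ℝ) (ξ : ℝ) :
    |leftMass L E f X ξ| ≤ B * ∫ θ, |f θ| :=
  abs_integral_mul_le hf ((abs_nonneg _).trans (hB 0)) (fun _ _ => hB _) _ _

theorem abs_rightMass_le (hf : Integrable f) {B : ℝ} (hB : ∀ x, |E x| ≤ B) (X : ℝ → ℝ) (ξ : ℝ) :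
    |rightMass L E f X ξ| ≤ B * ∫ θ, |f θ| :=
  abs_integral_mul_le hf ((abs_nonneg _).trans (hB 0)) (fun _ _ => hB _) _ _

theorem abs_flux_le (hf : Integrable f) {B : ℝ} (hB : ∀ x, |E x| ≤ B) (X : ℝ → ℝ) (ξ : ℝ) :
    |leftMass L E f X ξ * rightMass L E f X ξ| ≤ (B * ∫ θ, |f θ|) ^ 2 := by
  rw [abs_mul, sq]
  have := abs_leftMass_le (L := L) hf hB X ξ
  exact mul_le_mul this (abs_rightMass_le hf hB X ξ) (abs_nonneg _) ((abs_nonneg _).trans this)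

theorem abs_leftMass_sub_le (hf : Integrable f) (hfc : Continuous f) {K : NNReal}
    (hK : LipschitzWith K E) {X Y : ℝ → ℝ} (hX : Continuous X) (hY : Continuous Y) {d : ℝ}
    (hd0 : 0 ≤ d) (hd : ∀ θ, f θ ≠ 0 → |X θ - Y θ| ≤ d) (ξ : ℝ) :
    |leftMass L E f X ξ - leftMass L E f Y ξ| ≤ K * d * ∫ θ, |f θ| := by
  have hE := hK.continuous
  unfold leftMass
  rw [← intervalIntegral.integral_sub
    ((by fun_prop : Continuous fun θ => E (X θ) * f θ).intervalIntegrable _ _)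
    ((by fun_prop : Continuous fun θ => E (Y θ) * f θ).intervalIntegrable _ _)]
  simp_rw [← sub_mul]
  refine abs_integral_mul_le hf (by positivity) (fun θ hθ => ?_) _ _
  have := hK.dist_le_mul (X θ) (Y θ)
  rw [Real.dist_eq, Real.dist_eq] at this
  exact this.trans (by gcongr; exact hd θ hθ)

theorem abs_rightMass_sub_le (hf : Integrable f) (hfc : Continuous f) {K : NNReal}
    (hK : LipschitzWith K E) {X Y : ℝ → ℝ} (hX : Continuous X) (hY : Continuous Y) {d : ℝ}
    (hd0 : 0 ≤ d) (hd : ∀ θ, f θ ≠ 0 → |X θ - Y θ| ≤ d) (ξ : ℝ) :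
    |rightMass L E f X ξ - rightMass L E f Y ξ| ≤ K * d * ∫ θ, |f θ| := by
  have hE := hK.continuous
  unfold rightMass
  rw [← intervalIntegral.integral_sub
    ((by fun_prop : Continuous fun θ => E (-X θ) * f θ).intervalIntegrable _ _)
    ((by fun_prop : Continuous fun θ => E (-Y θ) * f θ).intervalIntegrable _ _)]
  simp_rw [← sub_mul]
  refine abs_integral_mul_le hf (by positivity) (fun θ hθ => ?_) _ _
  have := hK.dist_le_mul (-X θ) (-Y θ)
  rw [Real.dist_eq, Real.dist_eq, neg_sub_neg, abs_sub_comm (Y θ)] at this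
  exact this.trans (by gcongr; exact hd θ hθ)

theorem abs_flux_sub_le (hf : Integrable f) (hfc : Continuous f) {K : NNReal}
    (hK : LipschitzWith K E) {B : ℝ} (hB : ∀ x, |E x| ≤ B)
    {X Y : ℝ → ℝ} (hX : Continuous X) (hY : Continuous Y) {d : ℝ}
    (hd0 : 0 ≤ d) (hd : ∀ θ, f θ ≠ 0 → |X θ - Y θ| ≤ d) (ξ : ℝ) :
    |leftMass L E f X ξ * rightMass L E f X ξ - leftMass L E f Y ξ * rightMass L E f Y ξ|
      ≤ 2 * K * B * (∫ θ, |f θ|) ^ 2 * d := by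
  have hB0 := (abs_nonneg _).trans (hB 0)
  have hM : 0 ≤ ∫ θ, |f θ| := integral_nonneg fun _ => abs_nonneg _
  have e : leftMass L E f X ξ * rightMass L E f X ξ - leftMass L E f Y ξ * rightMass L E f Y ξ
      = leftMass L E f X ξ * (rightMass L E f X ξ - rightMass L E f Y ξ)
        + (leftMass L E f X ξ - leftMass L E f Y ξ) * rightMass L E f Y ξ := by ring
  rw [e]
  refine (abs_add_le _ _).trans ?_
  rw [abs_mul, abs_mul]
  have h1 := mul_le_mul (abs_leftMass_le (L := L) hf hB X ξ)
    (abs_rightMass_sub_le (L := L) hf hfc hK hX hY hd0 hd ξ) (abs_nonneg _) (by positivity)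
  have h2 := mul_le_mul (abs_leftMass_sub_le (L := L) hf hfc hK hX hY hd0 hd ξ)
    (abs_rightMass_le (L := L) hf hB Y ξ) (abs_nonneg _) (by positivity)
  linarith

/-- Uniqueness for the Lagrange dynamics, with `exp` truncated. Iterating the Lipschitz estimate
for the flux gives the bounds `C (Kt)ⁿ / n!` for the difference of two solutions. -/
theorem lagrange_ode_unique (hf : Integrable f) (hfc : Continuous f)
    (hfs : ∀ θ, f θ ≠ 0 → θ ∈ Icc (-L) L) (hE : IsTruncatedExp L E) {y z : ℝ → ℝ → ℝ} {s : ℝ}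
    (hy : ∀ t ∈ Icc 0 s, Continuous fun θ => y θ t) (hz : ∀ t ∈ Icc 0 s, Continuous fun θ => z θ t)
    (hy' : ∀ ξ ∈ Icc (-L) L, ∀ t ∈ Icc 0 s, HasDerivWithinAt (y ξ)
      (leftMass L E f (fun θ => y θ t) ξ * rightMass L E f (fun θ => y θ t) ξ) (Icc 0 s) t)
    (hz' : ∀ ξ ∈ Icc (-L) L, ∀ t ∈ Icc 0 s, HasDerivWithinAt (z ξ)
      (leftMass L E f (fun θ => z θ t) ξ * rightMass L E f (fun θ => z θ t) ξ) (Icc 0 s) t)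
    (h0 : ∀ ξ ∈ Icc (-L) L, y ξ 0 = z ξ 0) :
    ∀ ξ ∈ Icc (-L) L, ∀ t ∈ Icc 0 s, y ξ t = z ξ t := by
  obtain ⟨B, hB⟩ := hE.bounded
  obtain ⟨K, hK⟩ := hE.lipschitz
  have hB0 := (abs_nonneg _).trans (hB 0)
  set M := ∫ θ, |f θ| with hMdef
  have hM : 0 ≤ M := integral_nonneg fun _ => abs_nonneg _
  set k : ℝ := 2 * K * B * M ^ 2 with hk
  have hk0 : 0 ≤ k := by positivity
  set C : ℝ := 2 * (B * M) ^ 2 * s with hC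
  have hcont : ∀ ξ ∈ Icc (-L) L, ContinuousOn (fun t => y ξ t - z ξ t) (Icc 0 s) := fun ξ hξ =>
    (HasDerivWithinAt.continuousOn (hy' ξ hξ)).sub (HasDerivWithinAt.continuousOn (hz' ξ hξ))
  have hder : ∀ ξ ∈ Icc (-L) L, ∀ t ∈ Ico 0 s, HasDerivWithinAt (fun t => y ξ t - z ξ t)
      (leftMass L E f (fun θ => y θ t) ξ * rightMass L E f (fun θ => y θ t) ξ -
        leftMass L E f (fun θ => z θ t) ξ * rightMass L E f (fun θ => z θ t) ξ) (Ici t) t :=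
    fun ξ hξ t ht => (((hy' ξ hξ t (Ico_subset_Icc_self ht)).sub
      (hz' ξ hξ t (Ico_subset_Icc_self ht))).mono_of_mem_nhdsWithin
        (Icc_mem_nhdsGE_of_mem ht))
  have claim : ∀ n : ℕ, ∀ ξ ∈ Icc (-L) L, ∀ t ∈ Icc 0 s,
      |y ξ t - z ξ t| ≤ C * ((k * t) ^ n / n.factorial) := by
    intro n
    induction n with
    | zero =>
      intro ξ hξ t ht
      have := norm_image_sub_le_of_norm_deriv_right_le_segment (C := 2 * (B * M) ^ 2)
        (hcont ξ hξ) (hder ξ hξ) (fun r hr => by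
          refine (norm_sub_le _ _).trans ?_
          have h1 := abs_flux_le (L := L) hf hB (fun θ => y θ r) ξ
          have h2 := abs_flux_le (L := L) hf hB (fun θ => z θ r) ξ
          rw [Real.norm_eq_abs, Real.norm_eq_abs]; linarith) t ht
      rw [h0 ξ hξ, Real.norm_eq_abs] at this
      simp only [sub_self, sub_zero] at this
      simp only [pow_zero, Nat.factorial_zero, Nat.cast_one, div_one, mul_one]
      refine this.trans ?_
      rw [hC]; gcongr; exact ht.2
    | succ n ih =>
      intro ξ hξ t ht
      have hs0 : 0 ≤ s := ht.1.trans ht.2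
      have hC0 : 0 ≤ C := by positivity
      have hBd : ∀ x : ℝ, HasDerivAt (fun t => C * ((k * t) ^ (n + 1) / (n + 1).factorial))
          (k * (C * ((k * x) ^ n / n.factorial))) x := fun x => by
        have h1 : HasDerivAt (fun t : ℝ => k * t) k x := by
          simpa using (hasDerivAt_id x).const_mul k
        have h := ((h1.pow (n + 1)).div_const ((n + 1).factorial : ℝ)).const_mul C
        refine h.congr_deriv ?_
        rw [Nat.factorial_succ]
        push_cast
        have : ((n.factorial : ℕ) : ℝ) ≠ 0 := by positivity
        have : (n : ℝ) + 1 ≠ 0 := by positivity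
        field_simp
      refine image_norm_le_of_norm_deriv_right_le_deriv_boundary (hcont ξ hξ) (hder ξ hξ)
        (by simp [h0 ξ hξ]) hBd (fun r hr => ?_) ht
      have hr' := Ico_subset_Icc_self hr
      have hd0 : 0 ≤ C * ((k * r) ^ n / n.factorial) := by have := hr.1; positivity
      exact abs_flux_sub_le hf hfc hK hB (hy r hr') (hz r hr') hd0
        (fun θ hθ => ih θ (hfs θ hθ) r hr') ξ
  intro ξ hξ t ht
  have hlim : Tendsto (fun n : ℕ => C * ((k * t) ^ n / n.factorial)) atTop (𝓝 (C * 0)) :=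
    (FloorSemiring.tendsto_pow_div_factorial_atTop _).const_mul C
  rw [mul_zero] at hlim
  have := ge_of_tendsto' hlim fun n => claim n ξ hξ t ht
  exact sub_eq_zero.1 (abs_eq_zero.1 (le_antisymm this (abs_nonneg _)))

/-- `X` is the global solution of the truncated Lagrange dynamics. For `E = exp` and increasing
`X(·, t)` the product of moments is the velocity `u² - uₓ²`; truncating `exp` makes the vector
field bounded and globally Lipschitz, and makes sense of `X` for all labels and all real times. -/
structure IsTruncatedFlow (L : ℝ) (E f : ℝ → ℝ) (X : ℝ → ℝ → ℝ) : Prop where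
  continuous : Continuous fun p : ℝ × ℝ => X p.1 p.2
  hasDerivAt : ∀ ξ t, HasDerivAt (X ξ)
    (leftMass L E f (fun θ => X θ t) ξ * rightMass L E f (fun θ => X θ t) ξ) t
  initial : ∀ ξ, X ξ 0 = ξ

theorem exists_truncatedFlow (hf : Integrable f) (hfc : Continuous f) (hE : IsTruncatedExp L E) :
    ∃ X, IsTruncatedFlow L E f X := by
  obtain ⟨B, hB⟩ := hE.bounded
  obtain ⟨K, hK⟩ := hE.lipschitz
  have hEc := hK.continuous
  have hB0 := (abs_nonneg _).trans (hB 0)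
  have hM : 0 ≤ ∫ θ, |f θ| := integral_nonneg fun _ => abs_nonneg _
  -- The unknown is the displacement `X - id`, a bounded continuous function of the label.
  let pos : BoundedContinuousFunction ℝ ℝ → ℝ → ℝ := fun η θ => θ + η θ
  have hpos : ∀ η, Continuous (pos η) := fun η => continuous_id.add η.continuous
  have hcont : ∀ η, Continuous fun ξ => leftMass L E f (pos η) ξ * rightMass L E f (pos η) ξ := by
    intro η
    have := hpos η
    refine Continuous.mul ?_ ?_
    · exact intervalIntegral.continuous_primitive (fun a b =>
        (by fun_prop : Continuous fun θ => E (pos η θ) * f θ).intervalIntegrable a b) _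
    · unfold rightMass
      simp_rw [fun ξ => intervalIntegral.integral_symm (μ := volume)
        (f := fun θ => E (-pos η θ) * f θ) L ξ]
      exact (intervalIntegral.continuous_primitive (fun a b =>
        (by fun_prop : Continuous fun θ => E (-pos η θ) * f θ).intervalIntegrable a b) _).neg
  let V : BoundedContinuousFunction ℝ ℝ → BoundedContinuousFunction ℝ ℝ := fun η =>
    BoundedContinuousFunction.ofNormedAddCommGroup _ (hcont η) _
      (fun ξ => abs_flux_le hf hB (pos η) ξ)
  have hV : ∀ η, ‖V η‖ ≤ (B * ∫ θ, |f θ|) ^ 2 := fun η =>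
    BoundedContinuousFunction.norm_ofNormedAddCommGroup_le _ (by positivity) _
  have hVL : LipschitzWith (Real.toNNReal (2 * K * B * (∫ θ, |f θ|) ^ 2)) V := by
    refine LipschitzWith.of_dist_le_mul fun η ζ => ?_
    rw [Real.coe_toNNReal _ (by positivity),
      BoundedContinuousFunction.dist_le (by positivity)]
    intro ξ
    rw [Real.dist_eq]
    refine abs_flux_sub_le hf hfc hK hB (hpos η) (hpos ζ) dist_nonneg (fun θ _ => ?_) ξ
    have := BoundedContinuousFunction.dist_coe_le_dist (f := η) (g := ζ) θ
    rwa [Real.dist_eq, ← add_sub_add_left_eq_sub _ _ θ] at this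
  -- The displacement solves an autonomous equation with bounded, globally Lipschitz right-hand side.
  obtain ⟨η, hη0, hη⟩ := exists_global_solution (v := fun _ => V) (fun _ => hVL)
    (fun _ => continuous_const) (fun _ => hV) 0 0
  have hηc : Continuous η := continuous_iff_continuousAt.2 fun t => (hη t).continuousAt
  refine ⟨fun ξ t => ξ + η t ξ, ?_, fun ξ t => ?_, fun ξ => by simp [hη0]⟩
  · refine continuous_fst.add ?_
    exact continuous_eval.comp ((hηc.comp continuous_snd).prodMk continuous_fst)
  · have h := ((BoundedContinuousFunction.evalCLM ℝ ξ).hasFDerivAt.comp_hasDerivAt t (hη t))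
    exact h.const_add ξ

end Flux

/-! ### Regularity of the truncated flow -/

section Regularity

variable {L : ℝ} {E f : ℝ → ℝ} {X : ℝ → ℝ → ℝ}

/-- Along the flow this is `2 uₓ`: the quantity `h` in `∂ₜ X_ξ = f h`. Differentiating
the product of moments in `ξ` affects only their limits of integration, which is why `∂ₜ X_ξ`
involves no derivative of `X`. -/
noncomputable def slope2 (L : ℝ) (E f X : ℝ → ℝ) (ξ : ℝ) : ℝ :=
  E (X ξ) * rightMass L E f X ξ - E (-X ξ) * leftMass L E f X ξ

/-- The Jacobian `X_ξ` of a truncated flow, in the integrated form `1 + f ∫ 2 uₓ`, where the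
integral is over `[0, t]`. It is defined whether or not it is positive. -/
noncomputable def jac (L : ℝ) (E f : ℝ → ℝ) (X : ℝ → ℝ → ℝ) (ξ t : ℝ) : ℝ :=
  1 + f ξ * ∫ s in (0 : ℝ)..t, slope2 L E f (fun θ => X θ s) ξ

theorem hasDerivAt_leftMass (hE : Continuous E) (hf : Continuous f) {Y : ℝ → ℝ}
    (hY : Continuous Y) (ξ : ℝ) : HasDerivAt (leftMass L E f Y) (E (Y ξ) * f ξ) ξ :=
  (by fun_prop : Continuous fun θ => E (Y θ) * f θ).integral_hasStrictDerivAt _ _ |>.hasDerivAt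

theorem hasDerivAt_rightMass (hE : Continuous E) (hf : Continuous f) {Y : ℝ → ℝ}
    (hY : Continuous Y) (ξ : ℝ) : HasDerivAt (rightMass L E f Y) (-(E (-Y ξ) * f ξ)) ξ := by
  have h := ((by fun_prop : Continuous fun θ => E (-Y θ) * f θ).integral_hasStrictDerivAt
    L ξ).hasDerivAt.neg
  refine h.congr_of_eventuallyEq (Eventually.of_forall fun x => ?_)
  exact intervalIntegral.integral_symm _ _

theorem continuous_leftMass_uncurry (hE : Continuous E) (hf : Continuous f)
    (hX : Continuous fun p : ℝ × ℝ => X p.1 p.2) :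
    Continuous fun p : ℝ × ℝ => leftMass L E f (fun θ => X θ p.2) p.1 := by
  have h : Continuous (Function.uncurry fun (t θ : ℝ) => E (X θ t) * f θ) :=
    (hE.comp (hX.comp continuous_swap)).mul (hf.comp continuous_snd)
  exact (intervalIntegral.continuous_parametric_primitive_of_continuous (μ := volume)
    (a₀ := -L) h).comp continuous_swap

theorem continuous_rightMass_uncurry (hE : Continuous E) (hf : Continuous f)
    (hX : Continuous fun p : ℝ × ℝ => X p.1 p.2) :
    Continuous fun p : ℝ × ℝ => rightMass L E f (fun θ => X θ p.2) p.1 := by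
  have h : Continuous (Function.uncurry fun (t θ : ℝ) => E (-X θ t) * f θ) :=
    (hE.comp (hX.comp continuous_swap).neg).mul (hf.comp continuous_snd)
  refine ((intervalIntegral.continuous_parametric_primitive_of_continuous (μ := volume)
    (a₀ := L) h).comp continuous_swap).neg.congr fun p => ?_
  exact (intervalIntegral.integral_symm _ _).symm

theorem continuous_slope2_uncurry (hE : Continuous E) (hf : Continuous f)
    (hX : Continuous fun p : ℝ × ℝ => X p.1 p.2) :
    Continuous fun p : ℝ × ℝ => slope2 L E f (fun θ => X θ p.2) p.1 :=
  ((hE.comp hX).mul (continuous_rightMass_uncurry hE hf hX)).sub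
    ((hE.comp hX.neg).mul (continuous_leftMass_uncurry hE hf hX))

theorem continuous_jac (hE : Continuous E) (hf : Continuous f)
    (hX : Continuous fun p : ℝ × ℝ => X p.1 p.2) :
    Continuous fun p : ℝ × ℝ => jac L E f X p.1 p.2 :=
  continuous_const.add ((hf.comp continuous_fst).mul
    (intervalIntegral.continuous_parametric_primitive_of_continuous (μ := volume) (a₀ := 0)
      (f := fun ξ s => slope2 L E f (fun θ => X θ s) ξ)
      (continuous_slope2_uncurry (L := L) hE hf hX)))

namespace IsTruncatedFlow

variable (hX : IsTruncatedFlow L E f X) (hE : IsTruncatedExp L E) (hf : ContDiff ℝ 1 f)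
include hX hE hf

theorem eq_integral (ξ t : ℝ) : X ξ t = ξ + ∫ s in (0 : ℝ)..t,
    leftMass L E f (fun θ => X θ s) ξ * rightMass L E f (fun θ => X θ s) ξ := by
  have hEc := hE.contDiff.continuous
  have hc : Continuous fun s => leftMass L E f (fun θ => X θ s) ξ *
      rightMass L E f (fun θ => X θ s) ξ :=
    ((continuous_leftMass_uncurry hEc hf.continuous hX.continuous).mul
      (continuous_rightMass_uncurry hEc hf.continuous hX.continuous)).comp
      (Continuous.prodMk_right ξ)
  rw [intervalIntegral.integral_eq_sub_of_hasDerivAt (fun s _ => hX.hasDerivAt ξ s)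
    (hc.intervalIntegrable _ _), hX.initial]
  ring

theorem hasDerivAt_label (ξ t : ℝ) : HasDerivAt (fun η => X η t) (jac L E f X ξ t) ξ := by
  have hEc := hE.contDiff.continuous
  have hfc := hf.continuous
  have hXc := hX.continuous
  have hXt : ∀ t, Continuous fun θ => X θ t := fun t => hXc.comp (Continuous.prodMk_left t)
  have h := hasDerivAt_integral_of_continuous
    (g := fun η s => leftMass L E f (fun θ => X θ s) η * rightMass L E f (fun θ => X θ s) η)
    (g' := fun η s => f η * slope2 L E f (fun θ => X θ s) η)
    ((continuous_leftMass_uncurry hEc hfc hXc).mul (continuous_rightMass_uncurry hEc hfc hXc))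
    ((hfc.comp continuous_fst).mul (continuous_slope2_uncurry hEc hfc hXc))
    (fun η s => ((hasDerivAt_leftMass hEc hfc (hXt s) η).mul
      (hasDerivAt_rightMass hEc hfc (hXt s) η)).congr_deriv (by unfold slope2; ring)) 0 t ξ
  have h2 := (hasDerivAt_id ξ).add h
  rw [intervalIntegral.integral_const_mul] at h2
  exact h2.congr_of_eventuallyEq (Eventually.of_forall fun η => hX.eq_integral hE hf η t)

theorem contDiff : ContDiff ℝ 1 fun p : ℝ × ℝ => X p.1 p.2 := by
  have hEc := hE.contDiff.continuous
  have hfc := hf.continuous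
  have hXc := hX.continuous
  exact contDiff_one_of_partial_derivs (f := X) (hX.hasDerivAt_label hE hf) hX.hasDerivAt
    (continuous_jac hEc hfc hXc)
    ((continuous_leftMass_uncurry hEc hfc hXc).mul (continuous_rightMass_uncurry hEc hfc hXc))

/-- The derivative falls on `E` only, so the moments are as regular in time as the flow itself. -/
theorem hasDerivAt_leftMass_time (ξ t : ℝ) :
    HasDerivAt (fun s => leftMass L E f (fun θ => X θ s) ξ)
      (∫ θ in (-L)..ξ, deriv E (X θ t) * (leftMass L E f (fun θ => X θ t) θ *
        rightMass L E f (fun θ => X θ t) θ) * f θ) t := by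
  have hEc := hE.contDiff.continuous
  have hfc := hf.continuous
  have hXc := hX.continuous
  have hXs := hXc.comp continuous_swap
  have hE' : Continuous (deriv E) := hE.contDiff.continuous_deriv (by norm_num)
  refine hasDerivAt_integral_of_continuous (g := fun s θ => E (X θ s) * f θ)
    (g' := fun s θ => deriv E (X θ s) * (leftMass L E f (fun θ => X θ s) θ *
        rightMass L E f (fun θ => X θ s) θ) * f θ)
    ((hEc.comp hXs).mul (hfc.comp continuous_snd))
    (((hE'.comp hXs).mul (((continuous_leftMass_uncurry hEc hfc hXc).mul
      (continuous_rightMass_uncurry hEc hfc hXc)).comp continuous_swap)).mul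
      (hfc.comp continuous_snd)) (fun s θ => ?_) _ _ t
  have h := ((hE.contDiff.differentiable (by norm_num) (X θ s)).hasDerivAt.comp s
    (hX.hasDerivAt θ s)).mul_const (f θ)
  exact h

theorem hasDerivAt_rightMass_time (ξ t : ℝ) :
    HasDerivAt (fun s => rightMass L E f (fun θ => X θ s) ξ)
      (∫ θ in ξ..L, -(deriv E (-X θ t) * (leftMass L E f (fun θ => X θ t) θ *
        rightMass L E f (fun θ => X θ t) θ) * f θ)) t := by
  have hEc := hE.contDiff.continuous
  have hfc := hf.continuous
  have hXc := hX.continuous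
  have hXs := hXc.comp continuous_swap
  have hE' : Continuous (deriv E) := hE.contDiff.continuous_deriv (by norm_num)
  refine hasDerivAt_integral_of_continuous (g := fun s θ => E (-X θ s) * f θ)
    (g' := fun s θ => -(deriv E (-X θ s) * (leftMass L E f (fun θ => X θ s) θ *
        rightMass L E f (fun θ => X θ s) θ) * f θ))
    ((hEc.comp hXs.neg).mul (hfc.comp continuous_snd))
    (((hE'.comp hXs.neg).mul (((continuous_leftMass_uncurry hEc hfc hXc).mul
      (continuous_rightMass_uncurry hEc hfc hXc)).comp continuous_swap)).mul
      (hfc.comp continuous_snd)).neg (fun s θ => ?_) _ _ t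
  have h := ((hE.contDiff.differentiable (by norm_num) (-X θ s)).hasDerivAt.comp s
    (hX.hasDerivAt θ s).neg).mul_const (f θ)
  exact h.congr_deriv (by ring)

theorem contDiff_leftMass :
    ContDiff ℝ 1 fun p : ℝ × ℝ => leftMass L E f (fun θ => X θ p.2) p.1 := by
  have hEc := hE.contDiff.continuous
  have hfc := hf.continuous
  have hXc := hX.continuous
  have hXs := hXc.comp continuous_swap
  have hE' : Continuous (deriv E) := hE.contDiff.continuous_deriv (by norm_num)
  have hab := ((continuous_leftMass_uncurry (L := L) hEc hfc hXc).mul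
      (continuous_rightMass_uncurry (L := L) hEc hfc hXc)).comp continuous_swap
  refine contDiff_one_of_partial_derivs
    (f := fun ξ t => leftMass L E f (fun θ => X θ t) ξ)
    (fun ξ t => hasDerivAt_leftMass hEc hfc (hXc.comp (Continuous.prodMk_left t)) ξ)
    (hX.hasDerivAt_leftMass_time hE hf)
    ((hEc.comp hXc).mul (hfc.comp continuous_fst)) ?_
  exact (intervalIntegral.continuous_parametric_primitive_of_continuous (μ := volume) (a₀ := -L)
    (f := fun t θ => deriv E (X θ t) * (leftMass L E f (fun θ => X θ t) θ *
        rightMass L E f (fun θ => X θ t) θ) * f θ)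
    (((hE'.comp hXs).mul hab).mul (hfc.comp continuous_snd))).comp continuous_swap

theorem contDiff_rightMass :
    ContDiff ℝ 1 fun p : ℝ × ℝ => rightMass L E f (fun θ => X θ p.2) p.1 := by
  have hEc := hE.contDiff.continuous
  have hfc := hf.continuous
  have hXc := hX.continuous
  have hXs := hXc.comp continuous_swap
  have hE' : Continuous (deriv E) := hE.contDiff.continuous_deriv (by norm_num)
  have hab := ((continuous_leftMass_uncurry (L := L) hEc hfc hXc).mul
      (continuous_rightMass_uncurry (L := L) hEc hfc hXc)).comp continuous_swap
  refine contDiff_one_of_partial_derivs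
    (f := fun ξ t => rightMass L E f (fun θ => X θ t) ξ)
    (fun ξ t => hasDerivAt_rightMass hEc hfc (hXc.comp (Continuous.prodMk_left t)) ξ)
    (hX.hasDerivAt_rightMass_time hE hf)
    ((hEc.comp hXc.neg).mul (hfc.comp continuous_fst)).neg ?_
  refine ((intervalIntegral.continuous_parametric_primitive_of_continuous (μ := volume) (a₀ := L)
    (f := fun t θ => -(deriv E (-X θ t) * (leftMass L E f (fun θ => X θ t) θ *
        rightMass L E f (fun θ => X θ t) θ) * f θ))
    (((hE'.comp hXs.neg).mul hab).mul (hfc.comp continuous_snd)).neg).comp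
      continuous_swap).neg.congr fun p => ?_
  exact (intervalIntegral.integral_symm _ _).symm

theorem contDiff_slope2 :
    ContDiff ℝ 1 fun p : ℝ × ℝ => slope2 L E f (fun θ => X θ p.2) p.1 := by
  have hE1 : ContDiff ℝ 1 E := hE.contDiff.of_le (by norm_num)
  have hX1 := hX.contDiff hE hf
  exact ((hE1.comp hX1).mul (hX.contDiff_rightMass hE hf)).sub
    ((hE1.comp hX1.neg).mul (hX.contDiff_leftMass hE hf))

theorem contDiff_jac : ContDiff ℝ 1 fun p : ℝ × ℝ => jac L E f X p.1 p.2 := by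
  have hs := hX.contDiff_slope2 hE hf
  set g : ℝ → ℝ → ℝ := fun ξ t => slope2 L E f (fun θ => X θ t) ξ with hg
  have hgc : Continuous fun p : ℝ × ℝ => g p.1 p.2 := hs.continuous
  have hd : Continuous fun p : ℝ × ℝ => fderiv ℝ (fun p : ℝ × ℝ => g p.1 p.2) p (1, 0) :=
    (hs.continuous_fderiv one_ne_zero).clm_apply continuous_const
  have h1 : ∀ ξ t, HasDerivAt (fun η => g η t)
      (fderiv ℝ (fun p : ℝ × ℝ => g p.1 p.2) (ξ, t) (1, 0)) ξ := fun ξ t => by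
    have h := HasFDerivAt.comp_hasDerivAt (f := fun η : ℝ => (η, t)) ξ
      ((hs.differentiable one_ne_zero) (ξ, t)).hasFDerivAt
      ((hasDerivAt_id ξ).prodMk (hasDerivAt_const ξ t))
    exact h
  have hI : ContDiff ℝ 1 fun p : ℝ × ℝ => ∫ s in (0 : ℝ)..p.2, g p.1 s := by
    refine contDiff_one_of_partial_derivs (f := fun ξ t => ∫ s in (0 : ℝ)..t, g ξ s)
      (f₁ := fun ξ t => ∫ s in (0 : ℝ)..t,
        fderiv ℝ (fun p : ℝ × ℝ => g p.1 p.2) (ξ, s) (1, 0)) (f₂ := g)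
      (fun ξ t => hasDerivAt_integral_of_continuous
        (g' := fun ξ s => fderiv ℝ (fun p : ℝ × ℝ => g p.1 p.2) (ξ, s) (1, 0)) hgc hd h1 0 t ξ)
      (fun ξ t => ((hgc.comp (Continuous.prodMk_right ξ)).integral_hasStrictDerivAt 0 t).hasDerivAt)
      ?_ hgc
    exact intervalIntegral.continuous_parametric_primitive_of_continuous (μ := volume) (a₀ := 0)
      (f := fun ξ s => fderiv ℝ (fun p : ℝ × ℝ => g p.1 p.2) (ξ, s) (1, 0)) hd
  exact contDiff_const.add ((hf.comp contDiff_fst).mul hI)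

theorem hasDerivAt_jac_time (ξ t : ℝ) :
    HasDerivAt (jac L E f X ξ) (f ξ * slope2 L E f (fun θ => X θ t) ξ) t := by
  have hc := (hX.contDiff_slope2 hE hf).continuous.comp (Continuous.prodMk_right ξ)
  exact ((hc.integral_hasStrictDerivAt 0 t).hasDerivAt.const_mul (f ξ)).const_add 1

end IsTruncatedFlow

end Regularity

/-! ### Convolution with the kernel and geometry of the flow -/

section Convolution

variable {L : ℝ} {m : ℝ → ℝ}

theorem leftMass_eq_zero {E f X : ℝ → ℝ} (hf : ∀ θ ∉ Ioo (-L) L, f θ = 0) {ξ : ℝ} (hξ : ξ ≤ -L) :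
    leftMass L E f X ξ = 0 := by
  refine intervalIntegral.integral_zero_ae (Eventually.of_forall fun θ hθ => ?_)
  rw [uIoc_of_ge hξ] at hθ
  rw [hf θ fun h => absurd h.1 (not_lt.2 hθ.2), mul_zero]

theorem rightMass_eq_zero {E f X : ℝ → ℝ} (hf : ∀ θ ∉ Ioo (-L) L, f θ = 0) {ξ : ℝ} (hξ : L ≤ ξ) :
    rightMass L E f X ξ = 0 := by
  refine intervalIntegral.integral_zero_ae (Eventually.of_forall fun θ hθ => ?_)
  rw [uIoc_of_ge hξ] at hθ
  rw [hf θ fun h => absurd h.2 (not_lt.2 hθ.1.le), mul_zero]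

/-- Splitting the kernel at its kink writes `G ∗ m` with two exponential moments of `m`. -/
theorem convG_eq (hm : Continuous m) (hs : ∀ x ∉ Ioo (-L) L, m x = 0) (x : ℝ) :
    convG m x = (Real.exp (-x) * leftMass L Real.exp m id x
      + Real.exp x * rightMass L Real.exp m id x) / 2 := by
  have hGc : Continuous fun y => G (x - y) * m y := by unfold G; fun_prop
  have hcs : HasCompactSupport fun y => G (x - y) * m y := by
    refine HasCompactSupport.of_support_subset_isCompact (isCompact_Icc (a := -L) (b := L)) ?_
    intro y hy
    by_contra h
    exact hy (by simp [hs y fun h' => h (Ioo_subset_Icc_self h')])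
  have hint : Integrable fun y => G (x - y) * m y := hGc.integrable_of_hasCompactSupport hcs
  have hii : ∀ a b, IntervalIntegrable (fun y => G (x - y) * m y) volume a b := fun a b =>
    hGc.intervalIntegrable a b
  -- Enlarge `[-L, L]` to an interval `[a, b]` that contains `x` and carries the whole mass of `m`.
  set a := min x (-L) - 1 with ha
  set b := max x L + 1 with hb
  have hax : a ≤ x := by rw [ha]; linarith [min_le_left x (-L)]
  have hxb : x ≤ b := by rw [hb]; linarith [le_max_left x L]
  have haL : a ≤ -L := by rw [ha]; linarith [min_le_right x (-L)]
  have hLb : L ≤ b := by rw [hb]; linarith [le_max_right x L]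
  have e1 : convG m x = ∫ y in a..b, G (x - y) * m y := by
    unfold convG
    rw [intervalIntegral.integral_eq_integral_of_support_subset]
    intro y hy
    by_contra h
    exact hy (by simp [hs y fun h' => h ⟨by linarith [h'.1], by linarith [h'.2]⟩])
  have hexp : ∀ c d, IntervalIntegrable (fun y => Real.exp (id y) * m y) volume c d := fun c d =>
    (by fun_prop : Continuous fun y => Real.exp (id y) * m y).intervalIntegrable c d
  have hexp' : ∀ c d, IntervalIntegrable (fun y => Real.exp (-id y) * m y) volume c d := fun c d =>
    (by fun_prop : Continuous fun y => Real.exp (-id y) * m y).intervalIntegrable c d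
  have e2 : ∫ y in a..x, G (x - y) * m y = Real.exp (-x) / 2 * leftMass L Real.exp m id x := by
    have h0 : ∫ y in a..(-L), Real.exp (id y) * m y = 0 := by
      rw [intervalIntegral.integral_symm, neg_eq_zero]
      exact leftMass_eq_zero (E := Real.exp) (X := id) hs haL
    have h1 : leftMass L Real.exp m id x = ∫ y in a..x, Real.exp (id y) * m y := by
      rw [← intervalIntegral.integral_add_adjacent_intervals (hexp a (-L)) (hexp (-L) x), h0,
        zero_add]; rfl
    rw [h1, ← intervalIntegral.integral_const_mul]
    refine intervalIntegral.integral_congr fun y hy => ?_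
    rw [uIcc_of_le hax] at hy
    simp only [G, id]
    rw [abs_of_nonneg (by linarith [hy.2]), neg_sub, sub_eq_add_neg, Real.exp_add]
    ring
  have e3 : ∫ y in x..b, G (x - y) * m y = Real.exp x / 2 * rightMass L Real.exp m id x := by
    have h0 : ∫ y in L..b, Real.exp (-id y) * m y = 0 := by
      rw [intervalIntegral.integral_symm, neg_eq_zero]
      exact rightMass_eq_zero (E := Real.exp) (X := id) hs hLb
    have h1 : rightMass L Real.exp m id x = ∫ y in x..b, Real.exp (-id y) * m y := by
      rw [← intervalIntegral.integral_add_adjacent_intervals (hexp' x L) (hexp' L b), h0,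
        add_zero]; rfl
    rw [h1, ← intervalIntegral.integral_const_mul]
    refine intervalIntegral.integral_congr fun y hy => ?_
    rw [uIcc_of_le hxb] at hy
    simp only [G, id]
    rw [abs_of_nonpos (by linarith [hy.1]), neg_neg, sub_eq_add_neg, Real.exp_add]
    ring
  rw [e1, ← intervalIntegral.integral_add_adjacent_intervals (hii a x) (hii x b), e2, e3]
  ring

/-- The derivative of `G ∗ m`. -/
noncomputable def convG' (L : ℝ) (m : ℝ → ℝ) (x : ℝ) : ℝ :=
  (Real.exp x * rightMass L Real.exp m id x - Real.exp (-x) * leftMass L Real.exp m id x) / 2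

theorem hasDerivAt_convG (hm : Continuous m) (hs : ∀ x ∉ Ioo (-L) L, m x = 0) (x : ℝ) :
    HasDerivAt (convG m) (convG' L m x) x := by
  have h1 := hasDerivAt_leftMass (L := L) Real.continuous_exp hm continuous_id x
  have h2 := hasDerivAt_rightMass (L := L) Real.continuous_exp hm continuous_id x
  have h3 := (hasDerivAt_neg x).exp
  rw [funext (convG_eq hm hs)]
  refine (((h3.mul h1).add ((Real.hasDerivAt_exp x).mul h2)).div_const 2).congr_deriv ?_
  simp only [id, convG']
  ring

theorem hasDerivAt_convG' (hm : Continuous m) (hs : ∀ x ∉ Ioo (-L) L, m x = 0) (x : ℝ) :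
    HasDerivAt (convG' L m) (convG m x - m x) x := by
  have h1 := hasDerivAt_leftMass (L := L) Real.continuous_exp hm continuous_id x
  have h2 := hasDerivAt_rightMass (L := L) Real.continuous_exp hm continuous_id x
  have h3 := (hasDerivAt_neg x).exp
  have he : Real.exp x * Real.exp (-x) = 1 := by rw [← Real.exp_add]; simp
  rw [convG_eq hm hs]
  refine ((((Real.hasDerivAt_exp x).mul h2).sub (h3.mul h1)).div_const 2).congr_deriv ?_
  simp only [id]
  linear_combination (-m x) * he

/-- The velocity `u² - uₓ²` is the product of the two exponential moments. -/
theorem convG_sq_sub_convG'_sq (hm : Continuous m) (hs : ∀ x ∉ Ioo (-L) L, m x = 0) (x : ℝ) :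
    convG m x ^ 2 - convG' L m x ^ 2
      = leftMass L Real.exp m id x * rightMass L Real.exp m id x := by
  have he : Real.exp x * Real.exp (-x) = 1 := by rw [← Real.exp_add]; simp
  rw [convG_eq hm hs, convG']
  linear_combination (leftMass L Real.exp m id x * rightMass L Real.exp m id x) * he

/-- In Eulerian variables the moment of `f` along `Y` is the moment of the momentum `m` with
`m(Y) Y' = f`. -/
theorem leftMass_changeOfVariables {f Y Y' : ℝ → ℝ} (hm : Continuous m)
    (hY : ∀ θ, HasDerivAt Y (Y' θ) θ) (hY' : Continuous Y') (hL : Y (-L) = -L)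
    (hf : ∀ θ, m (Y θ) * Y' θ = f θ) (ξ : ℝ) :
    leftMass L Real.exp m id (Y ξ) = leftMass L Real.exp f Y ξ := by
  have h := intervalIntegral.integral_comp_mul_deriv (a := -L) (b := ξ)
    (g := fun y => Real.exp (id y) * m y) (fun θ _ => hY θ) hY'.continuousOn (by fun_prop)
  rw [hL] at h
  unfold leftMass
  rw [← h]
  refine intervalIntegral.integral_congr fun θ _ => ?_
  simp only [Function.comp, id, ← hf θ, mul_assoc]

theorem rightMass_changeOfVariables {f Y Y' : ℝ → ℝ} (hm : Continuous m)
    (hY : ∀ θ, HasDerivAt Y (Y' θ) θ) (hY' : Continuous Y') (hL : Y L = L)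
    (hf : ∀ θ, m (Y θ) * Y' θ = f θ) (ξ : ℝ) :
    rightMass L Real.exp m id (Y ξ) = rightMass L Real.exp f Y ξ := by
  have h := intervalIntegral.integral_comp_mul_deriv (a := ξ) (b := L)
    (g := fun y => Real.exp (-id y) * m y) (fun θ _ => hY θ) hY'.continuousOn (by fun_prop)
  rw [hL] at h
  unfold rightMass
  rw [← h]
  refine intervalIntegral.integral_congr fun θ _ => ?_
  simp only [Function.comp, id, ← hf θ, mul_assoc]

end Convolution

section Geometry

variable {L : ℝ} {E f : ℝ → ℝ} {X : ℝ → ℝ → ℝ}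

theorem jac_eq_one {ξ : ℝ} (h : f ξ = 0) (t : ℝ) : jac L E f X ξ t = 1 := by
  simp [jac, h]

theorem leftMass_eq_exp (hE : IsTruncatedExp L E) (hs : ∀ θ ∉ Ioo (-L) L, f θ = 0) {Y : ℝ → ℝ}
    (hY : ∀ θ ∈ Icc (-L) L, Y θ ∈ Icc (-L) L) (ξ : ℝ) :
    leftMass L E f Y ξ = leftMass L Real.exp f Y ξ := by
  refine intervalIntegral.integral_congr fun θ _ => ?_
  by_cases h : θ ∈ Ioo (-L) L
  · simp only [hE.eq_exp _ (hY θ (Ioo_subset_Icc_self h))]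
  · simp [hs θ h]

theorem rightMass_eq_exp (hE : IsTruncatedExp L E) (hs : ∀ θ ∉ Ioo (-L) L, f θ = 0) {Y : ℝ → ℝ}
    (hY : ∀ θ ∈ Icc (-L) L, Y θ ∈ Icc (-L) L) (ξ : ℝ) :
    rightMass L E f Y ξ = rightMass L Real.exp f Y ξ := by
  refine intervalIntegral.integral_congr fun θ _ => ?_
  by_cases h : θ ∈ Ioo (-L) L
  · have := hY θ (Ioo_subset_Icc_self h)
    simp only [hE.eq_exp (-Y θ) ⟨by linarith [this.2], by linarith [this.1]⟩]
  · simp [hs θ h]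

namespace IsTruncatedFlow

variable (hX : IsTruncatedFlow L E f X) (hE : IsTruncatedExp L E) (hf : ContDiff ℝ 1 f)
include hX hE hf

theorem strictMono {t : ℝ} (hJ : ∀ ξ, 0 < jac L E f X ξ t) : StrictMono fun ξ => X ξ t :=
  strictMono_of_deriv_pos fun ξ => by rw [(hX.hasDerivAt_label hE hf ξ t).deriv]; exact hJ ξ

variable (hs : ∀ θ ∉ Ioo (-L) L, f θ = 0)
include hs

/-- Particles outside the support do not move: one of the two moments vanishes there. -/
theorem eq_self {ξ : ℝ} (hξ : ξ ∉ Ioo (-L) L) (t : ℝ) : X ξ t = ξ := by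
  rw [hX.eq_integral hE hf, intervalIntegral.integral_zero_ae, add_zero]
  refine Eventually.of_forall fun s _ => ?_
  rcases le_or_gt ξ (-L) with h | h
  · rw [leftMass_eq_zero hs h, zero_mul]
  · rw [rightMass_eq_zero hs (not_lt.1 fun h' => hξ ⟨h, h'⟩), mul_zero]

theorem mem_Icc {t : ℝ} (hJ : ∀ ξ, 0 < jac L E f X ξ t) :
    ∀ ξ ∈ Icc (-L) L, X ξ t ∈ Icc (-L) L := fun ξ hξ => by
  have hm := (hX.strictMono hE hf hJ).monotone
  have h1 := hm hξ.1
  have h2 := hm hξ.2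
  simp only [hX.eq_self hE hf hs (ξ := -L) (by simp), hX.eq_self hE hf hs (ξ := L) (by simp)]
    at h1 h2
  exact ⟨h1, h2⟩

theorem surjective (hL : 0 < L) (t : ℝ) : Function.Surjective fun ξ => X ξ t := by
  intro x
  by_cases hx : x ∈ Ioo (-L) L
  · have hc : ContinuousOn (fun ξ => X ξ t) (Icc (-L) L) :=
      (hX.continuous.comp (Continuous.prodMk_left t)).continuousOn
    have := intermediate_value_Icc (by linarith) hc
    simp only [hX.eq_self hE hf hs (ξ := -L) (by simp),
      hX.eq_self hE hf hs (ξ := L) (by simp)] at this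
    obtain ⟨ξ, _, h⟩ := this (Ioo_subset_Icc_self hx)
    exact ⟨ξ, h⟩
  · exact ⟨x, hX.eq_self hE hf hs hx t⟩

/-- Positivity of the Jacobian is an open condition in time: outside the compact support of `f`
it equals one. -/
theorem exists_jac_pos_near {t : ℝ} (hJ : ∀ ξ, 0 < jac L E f X ξ t) :
    ∃ ε > 0, ∀ s ∈ Ioo (t - ε) (t + ε), ∀ ξ, 0 < jac L E f X ξ s := by
  have hc : Continuous fun p : ℝ × ℝ => jac L E f X p.1 p.2 :=
    continuous_jac hE.contDiff.continuous hf.continuous hX.continuous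
  have h1 : ∀ ξ ∈ Icc (-L) L, ∀ᶠ p : ℝ × ℝ in 𝓝 ξ ×ˢ 𝓝 t, 0 < jac L E f X p.1 p.2 := by
    intro ξ _
    rw [← nhds_prod_eq]
    exact hc.continuousAt.eventually_const_lt (hJ ξ)
  have h2 : ∀ᶠ s in 𝓝 t, ∀ ξ ∈ Icc (-L) L, 0 < jac L E f X ξ s := by
    refine isCompact_Icc.eventually_forall_of_forall_eventually fun ξ hξ => ?_
    rw [nhds_prod_eq]
    exact (tendsto_snd.prodMk tendsto_fst).eventually (h1 ξ hξ)
  obtain ⟨ε, hε, h⟩ := Metric.eventually_nhds_iff_ball.1 h2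
  refine ⟨ε, hε, fun s hs' ξ => ?_⟩
  by_cases hξ : ξ ∈ Ioo (-L) L
  · exact h s (by rwa [Real.ball_eq_Ioo]) ξ (Ioo_subset_Icc_self hξ)
  · rw [jac_eq_one (hs ξ hξ)]; exact one_pos

end IsTruncatedFlow

end Geometry

/-! ### Classical solutions from the flow -/

theorem timeInterval_ofReal {T : ℝ} (hT : 0 < T) : timeInterval (ENNReal.ofReal T) = Ico 0 T := by
  ext t
  simp only [timeInterval, mem_ofPred_eq, mem_Ico]
  exact and_congr_right fun _ => ENNReal.ofReal_lt_ofReal_iff hT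

theorem hasDerivAt_of_contDiffAt_fst {F : ℝ × ℝ → ℝ} {x t : ℝ} (h : ContDiffAt ℝ 1 F (x, t)) :
    HasDerivAt (fun y => F (y, t)) (fderiv ℝ F (x, t) (1, 0)) x :=
  HasFDerivAt.comp_hasDerivAt (f := fun y : ℝ => (y, t)) x
    (h.differentiableAt one_ne_zero).hasFDerivAt
    ((hasDerivAt_id x).prodMk (hasDerivAt_const x t))

theorem hasDerivAt_of_contDiffAt_snd {F : ℝ × ℝ → ℝ} {x t : ℝ} (h : ContDiffAt ℝ 1 F (x, t)) :
    HasDerivAt (fun s => F (x, s)) (fderiv ℝ F (x, t) (0, 1)) t :=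
  HasFDerivAt.comp_hasDerivAt (f := fun s : ℝ => (x, s)) t
    (h.differentiableAt one_ne_zero).hasFDerivAt
    ((hasDerivAt_const t x).prodMk (hasDerivAt_id t))

theorem iteratedDeriv_eq_of_hasDerivAt {g : ℕ → ℝ → ℝ} {k : ℕ}
    (h : ∀ j < k, ∀ x, HasDerivAt (g j) (g (j + 1) x) x) :
    ∀ j ≤ k, iteratedDeriv j (g 0) = g j := by
  intro j
  induction j with
  | zero => intro _; exact iteratedDeriv_zero
  | succ j ih =>
    intro hj
    rw [iteratedDeriv_succ, ih (by omega)]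
    exact funext fun x => (h j (by omega) x).deriv

/-- A function which is jointly `C¹` and has `k` jointly continuous space derivatives belongs to
the class `C^k_1`. -/
theorem isCkn_of_hasDerivAt {k : ℕ} {T : ℝ} {g : ℕ → ℝ → ℝ → ℝ}
    (hg : ∀ t ∈ Ico 0 T, ∀ j < k, ∀ x, HasDerivAt (fun y => g j y t) (g (j + 1) x t) x)
    (hc : ∀ j ≤ k, ContinuousOn (fun p : ℝ × ℝ => g j p.1 p.2) (univ ×ˢ Ico 0 T))
    (h1 : ∀ t ∈ Ico 0 T, ∀ x, ContDiffAt ℝ 1 (fun p : ℝ × ℝ => g 0 p.1 p.2) (x, t)) :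
    IsCkn k 1 univ (Ico 0 T) (g 0) := by
  have hit : ∀ t ∈ Ico 0 T, ∀ j ≤ k, iteratedDeriv j (fun x => g 0 x t) = fun x => g j x t :=
    fun t ht => iteratedDeriv_eq_of_hasDerivAt (g := fun j x => g j x t) (hg t ht)
  have hud : UniqueDiffOn ℝ (Ico (0 : ℝ) T) := uniqueDiffOn_Ico 0 T
  refine ⟨fun t ht => ?_, fun x _ => ?_, fun j hj => ?_, fun j hj => ?_⟩
  · rw [contDiffOn_univ]
    refine (contDiff_iff_iteratedDeriv (n := (k : ℕ∞))).2 ⟨fun j hj => ?_, fun j hj => ?_⟩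
    · rw [hit t ht j (by exact_mod_cast hj)]
      exact (hc j (by exact_mod_cast hj)).comp_continuous (f := fun x : ℝ => (x, t))
        (by fun_prop) fun x => ⟨trivial, ht⟩
    · have hj' : j < k := by exact_mod_cast hj
      rw [hit t ht j hj'.le]
      exact fun x => (hg t ht j hj' x).differentiableAt
  · intro t ht
    exact ((h1 t ht x).comp t (f := fun s : ℝ => (x, s)) (by fun_prop)).contDiffWithinAt
  · refine (hc j hj).congr fun p hp => ?_
    rw [iteratedDerivWithin_univ, hit p.2 hp.2 j hj]
  · interval_cases j
    · simp only [iteratedDerivWithin_zero]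
      intro p hp
      exact (h1 p.2 hp.2 p.1).continuousAt.continuousWithinAt
    · have : ContinuousOn (fun p : ℝ × ℝ =>
          fderiv ℝ (fun p : ℝ × ℝ => g 0 p.1 p.2) p (0, 1)) (univ ×ˢ Ico 0 T) := fun p hp =>
        (((h1 p.2 hp.2 p.1).continuousAt_fderiv one_ne_zero).clm_apply
          continuousAt_const).continuousWithinAt
      refine this.congr fun p hp => ?_
      rw [iteratedDerivWithin_one]
      exact (hasDerivAt_of_contDiffAt_snd (h1 p.2 hp.2 p.1)).hasDerivWithinAt.derivWithin
        (hud p.2 hp.2)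

section Eulerian

variable {L : ℝ} {E f : ℝ → ℝ} {X : ℝ → ℝ → ℝ}

/-- The back-to-labels map, the inverse of `ξ ↦ X(ξ, t)`; it is meaningful only at times at which
that map is a bijection. -/
noncomputable def label (X : ℝ → ℝ → ℝ) (x t : ℝ) : ℝ := Function.invFun (fun ξ => X ξ t) x

/-- The momentum density transported by the flow `X`: `m(X(ξ, t), t) X_ξ(ξ, t) = f(ξ)`. -/
noncomputable def momentum (L : ℝ) (E f : ℝ → ℝ) (X : ℝ → ℝ → ℝ) (x t : ℝ) : ℝ :=
  f (label X x t) / jac L E f X (label X x t) t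

namespace IsTruncatedFlow

section Label

variable (hX : IsTruncatedFlow L E f X) (hE : IsTruncatedExp L E) (hf : ContDiff ℝ 1 f)
  (hs : ∀ θ ∉ Ioo (-L) L, f θ = 0) (hL : 0 < L)

include hX hE hf hs hL in
theorem map_label (x t : ℝ) : X (label X x t) t = x :=
  Function.rightInverse_invFun (hX.surjective hE hf hs hL t) x

include hX hE hf in
theorem label_map {t : ℝ} (hJ : ∀ ξ, 0 < jac L E f X ξ t) (ξ : ℝ) : label X (X ξ t) t = ξ :=
  Function.leftInverse_invFun (hX.strictMono hE hf hJ).injective ξ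

include hX hE hf hs hL in
/-- The inverse function theorem for `(ξ, t) ↦ (X(ξ, t), t)`. -/
theorem contDiffAt_label {I : Set ℝ} (hI : IsOpen I) (hJ : ∀ t ∈ I, ∀ ξ, 0 < jac L E f X ξ t)
    {t : ℝ} (ht : t ∈ I) (x : ℝ) :
    ContDiffAt ℝ 1 (fun p : ℝ × ℝ => label X p.1 p.2) (x, t) := by
  set ξ := label X x t with hξ
  set Φ : ℝ × ℝ → ℝ × ℝ := fun p => (X p.1 p.2, p.2) with hΦ
  have hX1 : ContDiff ℝ 1 fun p : ℝ × ℝ => X p.1 p.2 := hX.contDiff hE hf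
  have hΦ1 : ContDiff ℝ 1 Φ := hX1.prodMk contDiff_snd
  set A := fderiv ℝ (fun p : ℝ × ℝ => X p.1 p.2) (ξ, t) with hA
  set j := jac L E f X ξ t with hj
  have hj0 : j ≠ 0 := (hJ t ht ξ).ne'
  have hAj : A (1, 0) = j := (hasDerivAt_of_contDiffAt_fst hX1.contDiffAt).unique
    (hX.hasDerivAt_label hE hf ξ t)
  set v := A (0, 1) with hv
  have hAv : ∀ p : ℝ × ℝ, A p = j * p.1 + v * p.2 := fun p => by
    have : p = p.1 • ((1 : ℝ), (0 : ℝ)) + p.2 • ((0 : ℝ), (1 : ℝ)) := by ext <;> simp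
    conv_lhs => rw [this]
    rw [map_add, map_smul, map_smul, hAj, ← hv]
    simp only [smul_eq_mul]; ring
  have hfd : HasFDerivAt Φ (A.prod (ContinuousLinearMap.snd ℝ ℝ ℝ)) (ξ, t) :=
    ((hX1.differentiable one_ne_zero _).hasFDerivAt).prodMk hasFDerivAt_snd
  let A' : ℝ × ℝ →L[ℝ] ℝ × ℝ :=
    (j⁻¹ • (ContinuousLinearMap.fst ℝ ℝ ℝ - v • ContinuousLinearMap.snd ℝ ℝ ℝ)).prod
      (ContinuousLinearMap.snd ℝ ℝ ℝ)
  let e : (ℝ × ℝ) ≃L[ℝ] (ℝ × ℝ) := ContinuousLinearEquiv.equivOfInverse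
    (A.prod (ContinuousLinearMap.snd ℝ ℝ ℝ)) A'
    (fun p => by ext <;> simp [A', hAv]; field_simp)
    (fun p => by ext <;> simp [A', hAv]; field_simp; ring)
  have hfd' : HasFDerivAt Φ (e : ℝ × ℝ →L[ℝ] ℝ × ℝ) (ξ, t) := hfd
  have hΦξ : Φ (ξ, t) = (x, t) := by
    simp only [hΦ, hξ, hX.map_label hE hf hs hL]
  have hinv := hΦ1.contDiffAt.to_localInverse hfd' one_ne_zero
  have hright := (hΦ1.contDiffAt.hasStrictFDerivAt' hfd' one_ne_zero).eventually_right_inverse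
  rw [hΦξ] at hinv hright
  refine hinv.fst.congr_of_eventuallyEq ?_
  have hmem : ∀ᶠ p : ℝ × ℝ in 𝓝 (x, t), p.2 ∈ I :=
    continuous_snd.continuousAt.eventually_mem (hI.mem_nhds ht)
  filter_upwards [hright, hmem] with p hp hpI
  set q := (hΦ1.contDiffAt.hasStrictFDerivAt' hfd' one_ne_zero).localInverse Φ e (ξ, t) p with hq
  have h2 : q.2 = p.2 := (congrArg Prod.snd hp :)
  have h1 : X q.1 p.2 = p.1 := by rw [← h2]; exact (congrArg Prod.fst hp :)
  rw [← h1]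
  exact hX.label_map hE hf (hJ _ hpI) q.1

include hX hE hf in
theorem momentum_map_mul_jac {t : ℝ} (hJ : ∀ ξ, 0 < jac L E f X ξ t) (ξ : ℝ) :
    momentum L E f X (X ξ t) t * jac L E f X ξ t = f ξ := by
  rw [momentum, hX.label_map hE hf hJ, div_mul_cancel₀ _ (hJ ξ).ne']

include hX hE hf hs in
theorem momentum_eq_zero {t : ℝ} (hJ : ∀ ξ, 0 < jac L E f X ξ t) {x : ℝ} (hx : x ∉ Ioo (-L) L) :
    momentum L E f X x t = 0 := by
  have h := hX.label_map hE hf hJ x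
  rw [hX.eq_self hE hf hs hx] at h
  rw [momentum, h, hs x hx, zero_div]

end Label

variable (hX : IsTruncatedFlow L E f X) (hE : IsTruncatedExp L E) (hf : ContDiff ℝ 1 f)
  (hs : ∀ θ ∉ Ioo (-L) L, f θ = 0) (hL : 0 < L)
include hX hE hf hs hL

theorem contDiffAt_momentum {I : Set ℝ} (hI : IsOpen I)
    (hJ : ∀ t ∈ I, ∀ ξ, 0 < jac L E f X ξ t) {t : ℝ} (ht : t ∈ I) (x : ℝ) :
    ContDiffAt ℝ 1 (fun p : ℝ × ℝ => momentum L E f X p.1 p.2) (x, t) := by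
  have h := hX.contDiffAt_label hE hf hs hL hI hJ ht x
  have hj := (hX.contDiff_jac hE hf).contDiffAt.comp (x, t)
    (f := fun p : ℝ × ℝ => (label X p.1 p.2, p.2)) (h.prodMk contDiffAt_snd)
  exact (hf.contDiffAt.comp (x, t) h).div hj (hJ t ht _).ne'

/-- As long as the Jacobian stays positive, the momentum transported by the flow is a classical
solution. -/
theorem isClassicalSolution {T ε : ℝ} (hT : 0 < T) (hε : 0 < ε)
    (hJ : ∀ t ∈ Ioo (-ε) T, ∀ ξ, 0 < jac L E f X ξ t) :
    IsClassicalSolution f (ENNReal.ofReal T)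
      (fun x t => convG (fun y => momentum L E f X y t) x) (momentum L E f X) := by
  set m := momentum L E f X with hm
  have hsub : ∀ t ∈ Ico 0 T, t ∈ Ioo (-ε) T := fun t ht => ⟨by linarith [ht.1], ht.2⟩
  have hm1 : ∀ t ∈ Ico 0 T, ∀ x, ContDiffAt ℝ 1 (fun p : ℝ × ℝ => m p.1 p.2) (x, t) :=
    fun t ht x => hX.contDiffAt_momentum hE hf hs hL isOpen_Ioo hJ (hsub t ht) x
  have hmc : ∀ t ∈ Ioo (-ε) T, Continuous fun x => m x t := fun t ht =>
    continuous_iff_continuousAt.2 fun x =>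
      (hX.contDiffAt_momentum hE hf hs hL isOpen_Ioo hJ ht x).continuousAt.comp
        (f := fun y : ℝ => (y, t)) (by fun_prop)
  have hm0 : ∀ t ∈ Ioo (-ε) T, ∀ x ∉ Ioo (-L) L, m x t = 0 := fun t ht x hx =>
    hX.momentum_eq_zero hE hf hs (hJ t ht) hx
  have hXL : X (-L) = fun _ => -L := funext (hX.eq_self hE hf hs (by simp))
  have hXL' : X L = fun _ => L := funext (hX.eq_self hE hf hs (by simp))
  have hjc : ∀ t, Continuous fun ξ => jac L E f X ξ t := fun t =>
    (hX.contDiff_jac hE hf).continuous.comp (Continuous.prodMk_left t)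
  have hα : ∀ t ∈ Ioo (-ε) T, ∀ ξ, leftMass L Real.exp (fun y => m y t) id (X ξ t)
      = leftMass L E f (fun θ => X θ t) ξ := fun t ht ξ => by
    rw [leftMass_eq_exp hE hs (hX.mem_Icc hE hf hs (hJ t ht))]
    exact leftMass_changeOfVariables (hmc t ht) (fun θ => hX.hasDerivAt_label hE hf θ t) (hjc t)
      (congrFun hXL t) (hX.momentum_map_mul_jac hE hf (hJ t ht)) ξ
  have hβ : ∀ t ∈ Ioo (-ε) T, ∀ ξ, rightMass L Real.exp (fun y => m y t) id (X ξ t)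
      = rightMass L E f (fun θ => X θ t) ξ := fun t ht ξ => by
    rw [rightMass_eq_exp hE hs (hX.mem_Icc hE hf hs (hJ t ht))]
    exact rightMass_changeOfVariables (hmc t ht) (fun θ => hX.hasDerivAt_label hE hf θ t) (hjc t)
      (congrFun hXL' t) (hX.momentum_map_mul_jac hE hf (hJ t ht)) ξ
  have hlab : ∀ t ∈ Ico 0 T, ∀ x,
      ContDiffAt ℝ 1 (fun p : ℝ × ℝ => (label X p.1 p.2, p.2)) (x, t) := fun t ht x =>
    (hX.contDiffAt_label hE hf hs hL isOpen_Ioo hJ (hsub t ht) x).prodMk contDiffAt_snd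
  have hnear : ∀ t ∈ Ico 0 T, ∀ x : ℝ, ∀ᶠ p : ℝ × ℝ in 𝓝 (x, t), p.2 ∈ Ioo (-ε) T :=
    fun t ht x => continuous_snd.continuousAt.eventually_mem (isOpen_Ioo.mem_nhds (hsub t ht))
  have hα1 : ∀ t ∈ Ico 0 T, ∀ x, ContDiffAt ℝ 1
      (fun p : ℝ × ℝ => leftMass L Real.exp (fun y => m y p.2) id p.1) (x, t) := fun t ht x => by
    refine ((hX.contDiff_leftMass hE hf).contDiffAt.comp (x, t)
      (hlab t ht x)).congr_of_eventuallyEq ?_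
    filter_upwards [hnear t ht x] with p hp
    rw [Function.comp, ← hα _ hp, hX.map_label hE hf hs hL]
  have hβ1 : ∀ t ∈ Ico 0 T, ∀ x, ContDiffAt ℝ 1
      (fun p : ℝ × ℝ => rightMass L Real.exp (fun y => m y p.2) id p.1) (x, t) := fun t ht x => by
    refine ((hX.contDiff_rightMass hE hf).contDiffAt.comp (x, t)
      (hlab t ht x)).congr_of_eventuallyEq ?_
    filter_upwards [hnear t ht x] with p hp
    rw [Function.comp, ← hβ _ hp, hX.map_label hE hf hs hL]
  have hexp : ∀ q : ℝ × ℝ, ContDiffAt ℝ 1 (fun p : ℝ × ℝ => Real.exp p.1) q := fun q =>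
    (Real.contDiff_exp.comp contDiff_fst).contDiffAt
  have hexp' : ∀ q : ℝ × ℝ, ContDiffAt ℝ 1 (fun p : ℝ × ℝ => Real.exp (-p.1)) q := fun q =>
    (Real.contDiff_exp.comp contDiff_fst.neg).contDiffAt
  set u : ℝ → ℝ → ℝ := fun x t => convG (fun y => m y t) x with hu
  set u₁ : ℝ → ℝ → ℝ := fun x t => convG' L (fun y => m y t) x with hu₁
  have hu1 : ∀ t ∈ Ico 0 T, ∀ x, ContDiffAt ℝ 1 (fun p : ℝ × ℝ => u p.1 p.2) (x, t) :=
    fun t ht x => by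
      refine ((((hexp' _).mul (hα1 t ht x)).add ((hexp _).mul
        (hβ1 t ht x))).div_const 2).congr_of_eventuallyEq ?_
      filter_upwards [hnear t ht x] with p hp
      exact convG_eq (hmc _ hp) (hm0 _ hp) _
  have hu₁1 : ∀ t ∈ Ico 0 T, ∀ x, ContDiffAt ℝ 1 (fun p : ℝ × ℝ => u₁ p.1 p.2) (x, t) :=
    fun t ht x => (((hexp _).mul (hβ1 t ht x)).sub ((hexp' _).mul (hα1 t ht x))).div_const 2
  set mx : ℝ → ℝ → ℝ := fun x t => fderiv ℝ (fun p : ℝ × ℝ => m p.1 p.2) (x, t) (1, 0) with hmx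
  have hmx' : ∀ t ∈ Ico 0 T, ∀ x, HasDerivAt (fun y => m y t) (mx x t) x := fun t ht x =>
    hasDerivAt_of_contDiffAt_fst (hm1 t ht x)
  have hmxc : ContinuousOn (fun p : ℝ × ℝ => mx p.1 p.2) (univ ×ˢ Ico 0 T) := fun p hp =>
    (((hm1 p.2 hp.2 p.1).continuousAt_fderiv one_ne_zero).clm_apply
      continuousAt_const).continuousWithinAt
  have hux : ∀ t ∈ Ico 0 T, ∀ x, HasDerivAt (fun y => u y t) (u₁ x t) x := fun t ht x =>
    hasDerivAt_convG (hmc t (hsub t ht)) (hm0 t (hsub t ht)) x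
  have huxx : ∀ t ∈ Ico 0 T, ∀ x, HasDerivAt (fun y => u₁ y t) (u x t - m x t) x := fun t ht x =>
    hasDerivAt_convG' (hmc t (hsub t ht)) (hm0 t (hsub t ht)) x
  have cont : ∀ {F : ℝ × ℝ → ℝ}, (∀ t ∈ Ico 0 T, ∀ x, ContDiffAt ℝ 1 F (x, t)) →
      ContinuousOn F (univ ×ˢ Ico 0 T) := fun h p hp =>
    (h p.2 hp.2 p.1).continuousAt.continuousWithinAt
  refine ⟨?_, ?_, ?_, ?_, ?_, ?_, ?_⟩ <;> (try rw [timeInterval_ofReal hT])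
  · let g : ℕ → ℝ → ℝ → ℝ := fun j => match j with
      | 0 => u
      | 1 => u₁
      | 2 => fun x t => u x t - m x t
      | _ => fun x t => u₁ x t - mx x t
    refine isCkn_of_hasDerivAt (g := g) (fun t ht j hj x => ?_) (fun j hj => ?_) hu1
    · interval_cases j
      · exact hux t ht x
      · exact huxx t ht x
      · exact (hux t ht x).sub (hmx' t ht x)
    · interval_cases j
      · exact cont hu1
      · exact cont hu₁1
      · exact (cont hu1).sub (cont hm1)
      · exact (cont hu₁1).sub hmxc
  · let g : ℕ → ℝ → ℝ → ℝ := fun j => match j with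
      | 0 => m
      | _ => mx
    refine isCkn_of_hasDerivAt (g := g) (fun t ht j hj x => ?_) (fun j hj => ?_) hm1
    · interval_cases j
      exact hmx' t ht x
    · interval_cases j
      · exact cont hm1
      · exact hmxc
  · intro T' hT'
    have hK : IsCompact (Icc (-L) L ×ˢ Icc 0 T') := isCompact_Icc.prod isCompact_Icc
    obtain ⟨K, hK⟩ := hK.exists_bound_of_continuousOn
      ((cont hm1).mono (prod_mono (subset_univ _) (Icc_subset_Ico_right hT'.2)))
    refine ⟨max K 0, fun t ht x => ?_⟩
    by_cases hx : x ∈ Ioo (-L) L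
    · exact (hK (x, t) ⟨Ioo_subset_Icc_self hx, ht⟩).trans (le_max_left _ _)
    · rw [hm0 t (hsub t ⟨ht.1, ht.2.trans_lt hT'.2⟩) x hx, abs_zero]
      exact le_max_right _ _
  · intro t ht x
    have h1 : deriv (fun y => u y t) = fun y => u₁ y t := funext fun y => (hux t ht y).deriv
    rw [iteratedDeriv_succ, iteratedDeriv_one, h1, (huxx t ht x).deriv]
    ring
  · intro t ht x; rfl
  · intro t ht x
    have h1 : deriv (fun y => u y t) = fun y => u₁ y t := funext fun y => (hux t ht y).deriv
    set D := fderiv ℝ (fun p : ℝ × ℝ => m p.1 p.2) (x, t) with hD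
    have hmt := (hasDerivAt_of_contDiffAt_snd (hm1 t ht x)).hasDerivWithinAt.derivWithin
      (uniqueDiffOn_Ico 0 T t ht)
    have hwm : HasDerivAt (fun y => (u y t ^ 2 - deriv (fun z => u z t) y ^ 2) * m y t)
        (2 * u₁ x t * m x t * m x t + (u x t ^ 2 - u₁ x t ^ 2) * mx x t) x := by
      rw [h1]
      refine ((((hux t ht x).pow 2).sub ((huxx t ht x).pow 2)).mul (hmx' t ht x)).congr_deriv ?_
      simp only [Pi.sub_apply, Pi.pow_apply]; push_cast; ring
    rw [hwm.deriv, hmt, ← hD]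
    -- Differentiate `m(X(ξ, s), s) X_ξ(ξ, s) = f(ξ)` at `s = t`, where `X(ξ, t) = x`.
    set ξ := label X x t with hξ
    have hξx : X ξ t = x := hX.map_label hE hf hs hL x t
    have hcurve : HasDerivAt (fun s => m (X ξ s) s)
        (D (leftMass L E f (fun θ => X θ t) ξ * rightMass L E f (fun θ => X θ t) ξ, 1)) t := by
      have h := HasFDerivAt.comp_hasDerivAt (l := fun p : ℝ × ℝ => m p.1 p.2)
        (f := fun s : ℝ => (X ξ s, s)) (l' := D) t
        (by rw [hξx]; exact ((hm1 t ht x).differentiableAt one_ne_zero).hasFDerivAt)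
        ((hX.hasDerivAt ξ t).prodMk (hasDerivAt_id t))
      exact h
    have hprod := hcurve.mul (hX.hasDerivAt_jac_time hE hf ξ t)
    have hconst : HasDerivAt (fun s => m (X ξ s) s * jac L E f X ξ s) 0 t := by
      refine (hasDerivAt_const t (f ξ)).congr_of_eventuallyEq ?_
      filter_upwards [isOpen_Ioo.mem_nhds (hsub t ht)] with s hs'
      exact hX.momentum_map_mul_jac hE hf (hJ s hs') ξ
    have hzero := hprod.unique hconst
    have hDlin : ∀ v : ℝ, D (v, 1) = v * mx x t + D (0, 1) := fun v => by
      have : (v, (1 : ℝ)) = v • ((1 : ℝ), (0 : ℝ)) + ((0 : ℝ), (1 : ℝ)) := by ext <;> simp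
      rw [this, map_add, map_smul, smul_eq_mul]
    have hw : leftMass L E f (fun θ => X θ t) ξ * rightMass L E f (fun θ => X θ t) ξ
        = u x t ^ 2 - u₁ x t ^ 2 := by
      rw [← hα t (hsub t ht), ← hβ t (hsub t ht), hξx]
      exact (convG_sq_sub_convG'_sq (hmc t (hsub t ht)) (hm0 t (hsub t ht)) x).symm
    have hslope : f ξ * slope2 L E f (fun θ => X θ t) ξ = f ξ * (2 * u₁ x t) := by
      by_cases h : ξ ∈ Ioo (-L) L
      · have hI := hX.mem_Icc hE hf hs (hJ t (hsub t ht)) ξ (Ioo_subset_Icc_self h)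
        rw [slope2, hE.eq_exp _ hI, hE.eq_exp (-X ξ t) ⟨by linarith [hI.2], by linarith [hI.1]⟩,
          ← hα t (hsub t ht), ← hβ t (hsub t ht), hξx]
        simp only [hu₁, convG']
        ring
      · rw [hs ξ h, zero_mul, zero_mul]
    have hmj : m x t * jac L E f X ξ t = f ξ := by
      have := hX.momentum_map_mul_jac hE hf (hJ t (hsub t ht)) ξ
      rwa [hξx] at this
    rw [hDlin, hw, hslope, hξx, ← hmj] at hzero
    have hj0 := (hJ t (hsub t ht) ξ).ne'
    refine mul_right_cancel₀ hj0 ?_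
    linear_combination hzero
  · intro _ x
    have h := hX.momentum_map_mul_jac hE hf (hJ 0 ⟨by linarith, hT⟩) x
    rw [hX.initial] at h
    simpa [jac] using h

end IsTruncatedFlow

end Eulerian

/-! ### Flows of scalar velocity fields and bounds for the convolution -/

section ScalarFlow

variable {w wx : ℝ → ℝ → ℝ} {K : ℝ}

/-- The secant slope of the velocity between two trajectories `y` and `z`. -/
noncomputable def secant (w : ℝ → ℝ → ℝ) (y z : ℝ → ℝ) (s : ℝ) : ℝ :=
  (w (z s) s - w (y s) s) / (z s - y s)

theorem abs_secant_le (hd : ∀ x t, HasDerivAt (fun y => w y t) (wx x t) x)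
    (hK : ∀ x t, |wx x t| ≤ K) (y z : ℝ → ℝ) (s : ℝ) : |secant w y z s| ≤ K := by
  have hK0 := (abs_nonneg _).trans (hK 0 0)
  have h := convex_univ.norm_image_sub_le_of_norm_hasDerivWithin_le (x := y s) (y := z s)
    (fun x _ => (hd x s).hasDerivWithinAt) (fun x _ => hK x s) trivial trivial
  rw [Real.norm_eq_abs, Real.norm_eq_abs] at h
  rw [secant, abs_div]
  exact div_le_of_le_mul₀ (abs_nonneg _) hK0 h

/-- The difference of two trajectories solves a linear equation whose coefficient is the secant
slope. -/
theorem sub_eq_mul_exp_integral_secant (hwc : Continuous fun p : ℝ × ℝ => w p.1 p.2)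
    {y z : ℝ → ℝ} (hy : ∀ t, HasDerivAt y (w (y t) t) t) (hz : ∀ t, HasDerivAt z (w (z t) t) t)
    (hne : ∀ t, y t ≠ z t) (t : ℝ) :
    z t - y t = (z 0 - y 0) * Real.exp (∫ s in (0 : ℝ)..t, secant w y z s) := by
  have hyc : Continuous y := continuous_iff_continuousAt.2 fun t => (hy t).continuousAt
  have hzc : Continuous z := continuous_iff_continuousAt.2 fun t => (hz t).continuousAt
  have hq : Continuous (secant w y z) :=
    ((hwc.comp (hzc.prodMk continuous_id)).sub (hwc.comp (hyc.prodMk continuous_id))).div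
      (hzc.sub hyc) fun s => sub_ne_zero.2 (hne s).symm
  have hI : ∀ t, HasDerivAt (fun t => ∫ s in (0 : ℝ)..t, secant w y z s) (secant w y z t) t :=
    fun t => (hq.integral_hasStrictDerivAt 0 t).hasDerivAt
  have hder : ∀ t, HasDerivAt
      (fun t => (z t - y t) * Real.exp (-∫ s in (0 : ℝ)..t, secant w y z s)) 0 t := fun t => by
    refine (((hz t).sub (hy t)).mul (hI t).neg.exp).congr_deriv ?_
    have : z t - y t ≠ 0 := sub_ne_zero.2 (hne t).symm
    simp only [secant, Pi.sub_apply]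
    field_simp
    ring
  have hc := is_const_of_deriv_eq_zero (fun t => (hder t).differentiableAt)
    (fun t => (hder t).deriv) t 0
  simp only [intervalIntegral.integral_same, neg_zero, Real.exp_zero, mul_one] at hc
  rw [← hc, mul_assoc, ← Real.exp_add]
  simp

/-- A bounded velocity field with bounded, continuous space derivative generates a flow of
diffeomorphisms of the line, whose Jacobian is the exponential of the integrated divergence. -/
theorem exists_scalar_flow (hwc : Continuous fun p : ℝ × ℝ => w p.1 p.2)
    (hd : ∀ x t, HasDerivAt (fun y => w y t) (wx x t) x) {B : ℝ} (hB : ∀ x t, |w x t| ≤ B)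
    (hK : ∀ x t, |wx x t| ≤ K) :
    ∃ Y : ℝ → ℝ → ℝ, (Continuous fun p : ℝ × ℝ => Y p.1 p.2) ∧ (∀ ξ, Y ξ 0 = ξ) ∧
      (∀ ξ t, HasDerivAt (Y ξ) (w (Y ξ t) t) t) ∧ (∀ t, Function.Surjective fun ξ => Y ξ t) ∧
      ∀ ξ t, HasDerivAt (fun η => Y η t) (Real.exp (∫ s in (0 : ℝ)..t, wx (Y ξ s) s)) ξ := by
  have hK0 := (abs_nonneg _).trans (hK 0 0)
  have hLip : ∀ t, LipschitzWith K.toNNReal fun x => w x t := fun t =>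
    LipschitzWith.of_dist_le_mul fun x y => by
      rw [Real.coe_toNNReal _ hK0, dist_comm, dist_comm x, Real.dist_eq, Real.dist_eq]
      exact convex_univ.norm_image_sub_le_of_norm_hasDerivWithin_le
        (fun x _ => (hd x t).hasDerivWithinAt) (fun x _ => hK x t) trivial trivial
  have hex := exists_global_solution (v := fun t x => w x t) hLip
    (fun x => hwc.comp (Continuous.prodMk_right x)) (B := B) (fun t x => hB x t)
  choose Y hY0 hY using fun ξ => hex 0 ξ
  have huniq : ∀ {y z : ℝ → ℝ} {t₀ : ℝ}, (∀ t, HasDerivAt y (w (y t) t) t) →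
      (∀ t, HasDerivAt z (w (z t) t) t) → y t₀ = z t₀ → y = z := fun hy hz h =>
    ODE_solution_unique_univ (v := fun t x => w x t) (s := fun _ => univ)
      (fun t => (hLip t).lipschitzOnWith) (fun t => ⟨hy t, trivial⟩) (fun t => ⟨hz t, trivial⟩) h
  have hne : ∀ {ξ η : ℝ}, ξ ≠ η → ∀ t, Y ξ t ≠ Y η t := fun {ξ η} h t ht => h (by
    rw [← hY0 ξ, ← hY0 η, huniq (hY ξ) (hY η) ht])
  have hdist : ∀ ξ η t, |Y η t - Y ξ t| ≤ |η - ξ| * Real.exp (K * |t|) := fun ξ η t => by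
    rcases eq_or_ne ξ η with rfl | h
    · simp
    · rw [sub_eq_mul_exp_integral_secant hwc (hY ξ) (hY η) (hne h), hY0, hY0, abs_mul,
        Real.abs_exp]
      gcongr
      have := intervalIntegral.norm_integral_le_of_norm_le_const (a := 0) (b := t)
        (f := secant w (Y ξ) (Y η)) (fun s _ => abs_secant_le hd hK (Y ξ) (Y η) s)
      rw [sub_zero] at this
      exact (le_abs_self _).trans this
  have hYc : Continuous fun p : ℝ × ℝ => Y p.1 p.2 := by
    refine continuous_iff_continuousAt.2 fun ⟨ξ, t⟩ => ?_
    have h1 : Tendsto (fun p : ℝ × ℝ => |p.1 - ξ| * Real.exp (K * |p.2|) + |Y ξ p.2 - Y ξ t|)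
        (𝓝 (ξ, t)) (𝓝 0) := by
      have hc : ContinuousAt (fun p : ℝ × ℝ =>
          |p.1 - ξ| * Real.exp (K * |p.2|) + |Y ξ p.2 - Y ξ t|) (ξ, t) := by
        have : ContinuousAt (fun p : ℝ × ℝ => Y ξ p.2) (ξ, t) :=
          ContinuousAt.comp (g := Y ξ) (hY ξ t).continuousAt continuousAt_snd
        exact (by fun_prop : ContinuousAt (fun p : ℝ × ℝ =>
          |p.1 - ξ| * Real.exp (K * |p.2|)) (ξ, t)).add (this.sub continuousAt_const).abs
      simpa [ContinuousAt] using hc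
    rw [ContinuousAt, tendsto_iff_dist_tendsto_zero]
    refine squeeze_zero (fun _ => dist_nonneg) (fun p => ?_) h1
    rw [Real.dist_eq]
    refine (abs_sub_le _ (Y ξ p.2) _).trans ?_
    gcongr
    exact hdist ξ p.1 p.2
  refine ⟨Y, hYc, hY0, hY, fun t x => ?_, fun ξ t => ?_⟩
  · obtain ⟨z, hz0, hz⟩ := hex t x
    refine ⟨z 0, ?_⟩
    have : Y (z 0) = z := huniq (t₀ := 0) (hY _) hz (hY0 _)
    simp only [this, hz0]
  · rw [hasDerivAt_iff_tendsto_slope]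
    have hslope : ∀ η, ξ ≠ η → slope (fun η => Y η t) ξ η
        = Real.exp (∫ s in (0 : ℝ)..t, secant w (Y ξ) (Y η) s) := fun η h => by
      rw [slope_def_field, sub_eq_mul_exp_integral_secant hwc (hY ξ) (hY η) (hne h), hY0, hY0,
        mul_div_cancel_left₀ _ (sub_ne_zero.2 h.symm)]
    have hev : ∀ᶠ η in 𝓝[≠] ξ, ξ ≠ η := by
      filter_upwards [self_mem_nhdsWithin] with η h using Ne.symm h
    refine Tendsto.congr' (hev.mono fun η h => (hslope η h).symm) ?_
    refine (Real.continuous_exp.tendsto _).comp ?_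
    refine intervalIntegral.tendsto_integral_filter_of_dominated_convergence (fun _ => K) ?_
      (Eventually.of_forall fun η => Eventually.of_forall fun s _ =>
        abs_secant_le hd hK (Y ξ) (Y η) s) intervalIntegrable_const
      (Eventually.of_forall fun s _ => ?_)
    · refine hev.mono fun η h => Continuous.aestronglyMeasurable ?_
      have c : ∀ ξ, Continuous (Y ξ) := fun ξ => hYc.comp (Continuous.prodMk_right ξ)
      exact ((hwc.comp ((c η).prodMk continuous_id)).sub
        (hwc.comp ((c ξ).prodMk continuous_id))).div ((c η).sub (c ξ))
        fun s => sub_ne_zero.2 (hne h s).symm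
    · have h1 : Tendsto (fun η => Y η s) (𝓝[≠] ξ) (𝓝[≠] (Y ξ s)) := by
        refine tendsto_nhdsWithin_iff.2 ⟨?_, hev.mono fun η h => (hne h s).symm⟩
        exact ((hYc.comp (Continuous.prodMk_left s)).tendsto ξ).mono_left nhdsWithin_le_nhds
      have h2 := (hasDerivAt_iff_tendsto_slope.1 (hd (Y ξ s) s)).comp h1
      refine h2.congr fun η => ?_
      simp only [Function.comp, slope_def_field, secant]

end ScalarFlow

/-- Chain rule along a curve for a function with a jointly continuous space derivative and a
pointwise time derivative. -/
theorem hasDerivWithinAt_comp_curve {F Fx : ℝ → ℝ → ℝ} {I : Set ℝ} {y : ℝ → ℝ} {t v Ft : ℝ}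
    (hF : ∀ s ∈ I, ∀ x, HasDerivAt (fun z => F z s) (Fx x s) x)
    (hc : ContinuousOn (fun p : ℝ × ℝ => Fx p.1 p.2) (univ ×ˢ I)) (ht : t ∈ I)
    (hFt : HasDerivWithinAt (F (y t)) Ft I t) (hy : HasDerivWithinAt y v I t) :
    HasDerivWithinAt (fun s => F (y s) s) (Fx (y t) t * v + Ft) I t := by
  have h1 : HasDerivWithinAt
      (fun s => F (y s) s - F (y t) s - Fx (y t) t * (y s - y t)) 0 I t := by
    have hO : (fun s => y s - y t) =O[𝓝[I] t] fun s => s - t :=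
      (HasDerivAtFilter.isBigO_sub hy).comp_tendsto
        (tendsto_id.prodMk (tendsto_const_pure (α := ℝ)))
    have ho : (fun s => F (y s) s - F (y t) s - Fx (y t) t * (y s - y t)) =o[𝓝[I] t]
        fun s => y s - y t := by
      rw [Asymptotics.isLittleO_iff]
      intro ε hε
      have hnear := Metric.continuousWithinAt_iff.1 (hc (y t, t) ⟨trivial, ht⟩) ε hε
      obtain ⟨δ, hδ, h⟩ := hnear
      have e1 : ∀ᶠ s in 𝓝[I] t, y s ∈ Metric.ball (y t) δ :=
        hy.continuousWithinAt (Metric.ball_mem_nhds _ hδ)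
      have e2 : ∀ᶠ s in 𝓝[I] t, s ∈ Metric.ball t δ :=
        mem_nhdsWithin_of_mem_nhds (Metric.ball_mem_nhds _ hδ)
      filter_upwards [e1, e2, self_mem_nhdsWithin] with s h1 h2 hs
      have hcv := (convex_ball (y t) δ).norm_image_sub_le_of_norm_hasDerivWithin_le
        (f := fun z => F z s - Fx (y t) t * z) (f' := fun z => Fx z s - Fx (y t) t)
        (x := y t) (y := y s) (C := ε)
        (fun z _ => ((hF s hs z).sub (by
          simpa using (hasDerivAt_id z).const_mul (Fx (y t) t))).hasDerivWithinAt)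
        (fun z hz => by
          have := h (x := (z, s)) ⟨trivial, hs⟩ (by
            rw [Prod.dist_eq]; exact max_lt hz h2)
          rw [Real.dist_eq] at this
          exact this.le) (Metric.mem_ball_self hδ) h1
      refine le_trans (le_of_eq ?_) hcv
      congr 1; ring
    rw [hasDerivWithinAt_iff_isLittleO]
    refine (ho.trans_isBigO hO).congr_left fun s => ?_
    simp
  have h2 := (h1.add hFt).add ((hy.sub_const (y t)).const_mul (Fx (y t) t))
  refine (h2.congr_deriv (by ring)).congr_of_mem (fun s _ => ?_) ht
  simp only [Pi.add_apply]
  ring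

theorem integrable_G : Integrable G := by
  have h : Integrable fun x : ℝ => Real.exp (-|x|) := by
    rw [← integrableOn_univ, ← Iic_union_Ioi (a := (0 : ℝ))]
    refine IntegrableOn.union ?_ ?_
    · refine (integrableOn_exp_Iic 0).congr_fun (fun x hx => ?_) measurableSet_Iic
      simp only [abs_of_nonpos (mem_Iic.1 hx), neg_neg]
    · refine (integrableOn_exp_neg_Ioi 0).congr_fun (fun x hx => ?_) measurableSet_Ioi
      simp only [abs_of_pos (mem_Ioi.1 hx)]
  exact h.div_const 2

theorem abs_convG_le {m : ℝ → ℝ} {K : ℝ} (hm : ∀ x, |m x| ≤ K) (x : ℝ) :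
    |convG m x| ≤ (∫ y, G y) * K := by
  have hG : ∀ y, 0 ≤ G y := fun y => by unfold G; positivity
  have hi : Integrable fun y => G (x - y) * K := (integrable_G.comp_sub_left x).mul_const K
  have h := norm_integral_le_of_norm_le hi (Eventually.of_forall fun y => by
    rw [norm_mul, Real.norm_eq_abs, Real.norm_eq_abs, abs_of_nonneg (hG _)]
    exact mul_le_mul_of_nonneg_left (hm y) (hG _) : ∀ᵐ y, ‖G (x - y) * m y‖ ≤ G (x - y) * K)
  rwa [integral_mul_const, integral_sub_left_eq_self] at h

/-- A bounded function with bounded second derivative has bounded first derivative. -/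
theorem abs_deriv_le_of_bounded {u u₁ u₂ : ℝ → ℝ} (h1 : ∀ x, HasDerivAt u (u₁ x) x)
    (h2 : ∀ x, HasDerivAt u₁ (u₂ x) x) {A B : ℝ} (hA : ∀ x, |u x| ≤ A) (hB : ∀ x, |u₂ x| ≤ B)
    (x : ℝ) : |u₁ x| ≤ 2 * A + B := by
  obtain ⟨c, hc, hc'⟩ := exists_hasDerivAt_eq_slope u u₁ (lt_add_one x)
    (fun y _ => (h1 y).continuousAt.continuousWithinAt) fun y _ => h1 y
  have h3 := convex_univ.norm_image_sub_le_of_norm_hasDerivWithin_le (x := c) (y := x)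
    (fun y _ => (h2 y).hasDerivWithinAt) (fun y _ => hB y) trivial trivial
  rw [Real.norm_eq_abs, Real.norm_eq_abs] at h3
  have hB0 := (abs_nonneg _).trans (hB 0)
  have h4 : |x - c| ≤ 1 := by rw [abs_le]; constructor <;> linarith [hc.1, hc.2]
  have h5 : B * |x - c| ≤ B := mul_le_of_le_one_right hB0 h4
  have h6 : |u₁ c| ≤ 2 * A := by
    rw [hc', add_sub_cancel_left, div_one]
    refine (abs_sub _ _).trans ?_
    linarith [hA x, hA (x + 1)]
  have h7 := abs_sub_abs_le_abs_sub (u₁ x) (u₁ c)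
  linarith

/-! ### Characteristics of a classical solution -/

section FromSolution

variable {f : ℝ → ℝ} {T : ℝ≥0∞} {u m : ℝ → ℝ → ℝ}

theorem Icc_subset_timeInterval {τ : ℝ} (hτ : τ ∈ timeInterval T) : Icc 0 τ ⊆ timeInterval T :=
  fun _ ht => ⟨ht.1, (ENNReal.ofReal_le_ofReal ht.2).trans_lt hτ.2⟩

/-- The characteristics `∂ₜ Y = (u² - uₓ²)(Y, t)` of a classical solution, with the conservation
law `m(Y(ξ, t), t) Y_ξ(ξ, t) = m₀(ξ)`. -/
theorem IsClassicalSolution.exists_characteristics (hsol : IsClassicalSolution f T u m) {τ : ℝ}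
    (hτ : τ ∈ timeInterval T) :
    ∃ Y Y' : ℝ → ℝ → ℝ, (Continuous fun p : ℝ × ℝ => Y p.1 p.2) ∧ (∀ ξ, Y ξ 0 = ξ) ∧
      (∀ ξ, ∀ t ∈ Icc 0 τ, HasDerivWithinAt (Y ξ)
        (u (Y ξ t) t ^ 2 - deriv (fun x => u x t) (Y ξ t) ^ 2) (Icc 0 τ) t) ∧
      (∀ t, Function.Surjective fun ξ => Y ξ t) ∧ (∀ ξ t, 0 < Y' ξ t) ∧
      (∀ t, Continuous fun ξ => Y' ξ t) ∧ (∀ ξ t, HasDerivAt (fun η => Y η t) (Y' ξ t) ξ) ∧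
      ∀ t ∈ Icc 0 τ, ∀ ξ, m (Y ξ t) t * Y' ξ t = f ξ := by
  have hτ0 : 0 ≤ τ := hτ.1
  have hT : 0 < T := zero_le.trans_lt hτ.2
  have hI := Icc_subset_timeInterval hτ
  set u₁ : ℝ → ℝ → ℝ := fun x t => deriv (fun z => u z t) x with hu₁
  set mx : ℝ → ℝ → ℝ := fun x t => deriv (fun z => m z t) x with hmx
  have huc : ContinuousOn (fun p : ℝ × ℝ => u p.1 p.2) (univ ×ˢ timeInterval T) := by
    simpa using hsol.regular_u.continuousOn_space 0 (by norm_num)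
  have hu₁c : ContinuousOn (fun p : ℝ × ℝ => u₁ p.1 p.2) (univ ×ˢ timeInterval T) := by
    simpa [iteratedDerivWithin_univ, iteratedDeriv_one] using
      hsol.regular_u.continuousOn_space 1 (by norm_num)
  have hmc : ContinuousOn (fun p : ℝ × ℝ => m p.1 p.2) (univ ×ˢ timeInterval T) := by
    simpa using hsol.regular_m.continuousOn_space 0 (by norm_num)
  have hmxc : ContinuousOn (fun p : ℝ × ℝ => mx p.1 p.2) (univ ×ˢ timeInterval T) := by
    simpa [iteratedDerivWithin_univ, iteratedDeriv_one] using
      hsol.regular_m.continuousOn_space 1 (by norm_num)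
  have hud : ∀ t ∈ timeInterval T, ContDiff ℝ 3 fun x => u x t := fun t ht =>
    contDiffOn_univ.1 (hsol.regular_u.contDiffOn_space t ht)
  have hux : ∀ t ∈ timeInterval T, ∀ x, HasDerivAt (fun y => u y t) (u₁ x t) x := fun t ht x =>
    ((hud t ht).differentiable (by norm_num) x).hasDerivAt
  have huxx : ∀ t ∈ timeInterval T, ∀ x, HasDerivAt (fun y => u₁ y t) (u x t - m x t) x :=
    fun t ht x => by
      have h1 : ContDiff ℝ 2 (deriv fun y => u y t) := by
        have h3 : ContDiff ℝ (2 + 1) fun y => u y t := by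
          rw [show (2 + 1 : WithTop ℕ∞) = 3 by norm_num]; exact hud t ht
        exact (contDiff_succ_iff_deriv.1 h3).2.2
      have h2 := (h1.differentiable (by norm_num) x).hasDerivAt
      have h3 := hsol.helmholtz t ht x
      rw [iteratedDeriv_succ, iteratedDeriv_one] at h3
      refine h2.congr_deriv ?_
      linarith
  have hmx' : ∀ t ∈ timeInterval T, ∀ x, HasDerivAt (fun y => m y t) (mx x t) x := fun t ht x =>
    ((contDiffOn_univ.1 (hsol.regular_m.contDiffOn_space t ht)).differentiable
      (by norm_num) x).hasDerivAt
  have hw : ∀ t ∈ timeInterval T, ∀ x, HasDerivAt (fun y => u y t ^ 2 - u₁ y t ^ 2)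
      (2 * u₁ x t * m x t) x := fun t ht x => by
    refine (((hux t ht x).pow 2).sub ((huxx t ht x).pow 2)).congr_deriv ?_
    push_cast; ring
  -- Bounds on the strip `[0, τ]`.
  obtain ⟨K, hK⟩ := hsol.bounded τ hτ
  have hK0 : 0 ≤ K := (abs_nonneg _).trans (hK 0 ⟨le_rfl, hτ0⟩ 0)
  have hG0 : 0 ≤ ∫ y, G y := integral_nonneg fun y => by unfold G; positivity
  set A := (∫ y, G y) * K with hA
  have hA0 : 0 ≤ A := by positivity
  have hub : ∀ t ∈ Icc 0 τ, ∀ x, |u x t| ≤ A := fun t ht x => by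
    rw [hsol.conv t (hI ht) x]
    exact abs_convG_le (hK t ht) x
  set D := 2 * A + (A + K) with hD
  have hD0 : 0 ≤ D := by positivity
  have hu₁b : ∀ t ∈ Icc 0 τ, ∀ x, |u₁ x t| ≤ D := fun t ht x =>
    abs_deriv_le_of_bounded (hux t (hI ht)) (huxx t (hI ht)) (hub t ht)
      (fun x => (abs_sub _ _).trans (add_le_add (hub t ht x) (hK t ht x))) x
  -- Freeze the velocity outside the time interval `[0, τ]`.
  set c : ℝ → ℝ := fun t => max 0 (min τ t) with hc
  have hcc : Continuous c := by fun_prop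
  have hcI : ∀ t, c t ∈ Icc 0 τ := fun t =>
    ⟨le_max_left _ _, max_le hτ0 (min_le_left _ _)⟩
  have hct : ∀ t ∈ Icc 0 τ, c t = t := fun t ht => by
    simp only [hc, min_eq_right ht.2, max_eq_right ht.1]
  have hcomp : ∀ {F : ℝ → ℝ → ℝ},
      ContinuousOn (fun p : ℝ × ℝ => F p.1 p.2) (univ ×ˢ timeInterval T) →
      Continuous fun p : ℝ × ℝ => F p.1 (c p.2) := fun hF =>
    hF.comp_continuous (f := fun p : ℝ × ℝ => (p.1, c p.2)) (by fun_prop)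
      fun p => ⟨trivial, hI (hcI p.2)⟩
  have hwxc : Continuous fun p : ℝ × ℝ => 2 * u₁ p.1 (c p.2) * m p.1 (c p.2) :=
    (continuous_const.mul (hcomp hu₁c)).mul (hcomp hmc)
  obtain ⟨Y, hYc, hY0, hYt, hYs, hYξ⟩ := exists_scalar_flow
    (w := fun x t => u x (c t) ^ 2 - u₁ x (c t) ^ 2)
    (wx := fun x t => 2 * u₁ x (c t) * m x (c t)) (K := 2 * D * K) (B := A ^ 2 + D ^ 2)
    (((hcomp huc).pow 2).sub ((hcomp hu₁c).pow 2))
    (fun x t => hw (c t) (hI (hcI t)) x)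
    (fun x t => by
      refine (abs_sub _ _).trans ?_
      rw [abs_pow, abs_pow]
      gcongr
      · exact hub _ (hcI t) x
      · exact hu₁b _ (hcI t) x)
    (fun x t => by
      rw [abs_mul, abs_mul, abs_two]
      gcongr
      · exact hu₁b _ (hcI t) x
      · exact hK _ (hcI t) x)
  have hgc : Continuous fun p : ℝ × ℝ => 2 * u₁ (Y p.1 p.2) (c p.2) * m (Y p.1 p.2) (c p.2) :=
    hwxc.comp (hYc.prodMk continuous_snd)
  have hYt' : ∀ ξ, ∀ t ∈ Icc 0 τ, HasDerivWithinAt (Y ξ)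
      (u (Y ξ t) t ^ 2 - u₁ (Y ξ t) t ^ 2) (Icc 0 τ) t := fun ξ t ht => by
    have := (hYt ξ t).hasDerivWithinAt (s := Icc 0 τ)
    rwa [hct t ht] at this
  refine ⟨Y, fun ξ t => Real.exp (∫ s in (0 : ℝ)..t, 2 * u₁ (Y ξ s) (c s) * m (Y ξ s) (c s)), hYc,
    hY0, hYt', hYs, fun _ _ => Real.exp_pos _, fun t => ?_, hYξ, fun t ht ξ => ?_⟩
  · exact Real.continuous_exp.comp
      (intervalIntegral.continuous_parametric_intervalIntegral_of_continuous'
        (f := fun ξ s => 2 * u₁ (Y ξ s) (c s) * m (Y ξ s) (c s)) hgc 0 t)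
  · -- `m_t + (u² - uₓ²) mₓ = -2 uₓ m²` along characteristics, so `m Y_ξ` is conserved.
    have hder : ∀ s ∈ Icc 0 τ, HasDerivWithinAt (fun s => m (Y ξ s) s *
        Real.exp (∫ r in (0 : ℝ)..s, 2 * u₁ (Y ξ r) (c r) * m (Y ξ r) (c r))) 0 (Icc 0 τ) s := by
      intro s hs
      have hmt : HasDerivWithinAt (m (Y ξ s)) (derivWithin (fun s' => m (Y ξ s) s')
          (timeInterval T) s) (Icc 0 τ) s :=
        ((((hsol.regular_m.contDiffOn_time (Y ξ s) trivial).differentiableOn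
          (by norm_num)) s (hI hs)).hasDerivWithinAt).mono hI
      have heq := hsol.equation s (hI hs) (Y ξ s)
      have hwm : HasDerivAt (fun y => (u y s ^ 2 - deriv (fun z => u z s) y ^ 2) * m y s)
          (2 * u₁ (Y ξ s) s * m (Y ξ s) s * m (Y ξ s) s +
            (u (Y ξ s) s ^ 2 - u₁ (Y ξ s) s ^ 2) * mx (Y ξ s) s) (Y ξ s) :=
        (hw s (hI hs) (Y ξ s)).mul (hmx' s (hI hs) (Y ξ s))
      rw [hwm.deriv] at heq
      have h1 := hasDerivWithinAt_comp_curve (fun s' hs' => hmx' s' (hI hs'))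
        (hmxc.mono (prod_mono_right hI)) hs hmt (hYt' ξ s hs)
      have h2 : HasDerivAt (fun s => ∫ r in (0 : ℝ)..s, 2 * u₁ (Y ξ r) (c r) * m (Y ξ r) (c r))
          (2 * u₁ (Y ξ s) (c s) * m (Y ξ s) (c s)) s :=
        ((hgc.comp (Continuous.prodMk_right ξ)).integral_hasStrictDerivAt 0 s).hasDerivAt
      rw [hct s hs] at h2
      refine (h1.mul h2.exp.hasDerivWithinAt).congr_deriv ?_
      linear_combination
        Real.exp (∫ r in (0 : ℝ)..s, 2 * u₁ (Y ξ r) (c r) * m (Y ξ r) (c r)) * heq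
    have hconst := constant_of_has_deriv_right_zero
      (HasDerivWithinAt.continuousOn hder) (fun s hs =>
        (hder s (Ico_subset_Icc_self hs)).mono_of_mem_nhdsWithin (Icc_mem_nhdsGE_of_mem hs)) t ht
    rw [hconst]
    simp [hY0, hsol.initial hT]

theorem integrable_of_eq_zero {L : ℝ} (hf : Continuous f) (hs : ∀ θ ∉ Ioo (-L) L, f θ = 0) :
    Integrable f :=
  hf.integrable_of_hasCompactSupport
    (HasCompactSupport.of_support_subset_isCompact (isCompact_Icc (a := -L) (b := L)) fun θ hθ => by
      by_contra h
      exact hθ (hs θ fun h' => h (Ioo_subset_Icc_self h')))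

/-- A classical solution is transported by the truncated flow: the Jacobian of the flow is positive
on its time interval, and `m(X(ξ, t), t) X_ξ(ξ, t) = m₀(ξ)`. -/
theorem IsClassicalSolution.jac_pos {L : ℝ} {E : ℝ → ℝ} {X : ℝ → ℝ → ℝ}
    (hX : IsTruncatedFlow L E f X) (hE : IsTruncatedExp L E) (hf : ContDiff ℝ 1 f)
    (hs : ∀ θ ∉ Ioo (-L) L, f θ = 0) (hsol : IsClassicalSolution f T u m) {τ : ℝ}
    (hτ : τ ∈ timeInterval T) (ξ : ℝ) :
    0 < jac L E f X ξ τ ∧ m (X ξ τ) τ * jac L E f X ξ τ = f ξ := by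
  obtain ⟨Y, Y', hYc, hY0, hYt, hYs, hY'0, hY'c, hYξ, hmY⟩ := hsol.exists_characteristics hτ
  have hI := Icc_subset_timeInterval hτ
  have hτ0 : 0 ≤ τ := hτ.1
  have hmono : ∀ t, StrictMono fun ξ => Y ξ t := fun t =>
    strictMono_of_deriv_pos fun ξ => by rw [(hYξ ξ t).deriv]; exact hY'0 ξ t
  have hmc : ∀ t ∈ Icc 0 τ, Continuous fun x => m x t := fun t ht =>
    (contDiffOn_univ.1 (hsol.regular_m.contDiffOn_space t (hI ht))).continuous
  have hm0 : ∀ t ∈ Icc 0 τ, ∀ η, f η = 0 → m (Y η t) t = 0 := fun t ht η hη => by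
    have := hmY t ht η
    rw [hη] at this
    exact (mul_eq_zero.1 this).resolve_right (hY'0 η t).ne'
  -- On a large interval that contains the support of `m(·, t)`, the velocity is a product of moments.
  have hvel : ∀ {R : ℝ}, ∀ t ∈ Icc 0 τ, (∀ x ∉ Ioo (-R) R, m x t = 0) → ∀ x,
      u x t ^ 2 - deriv (fun z => u z t) x ^ 2 = leftMass R Real.exp (fun y => m y t) id x *
        rightMass R Real.exp (fun y => m y t) id x := fun {R} t ht hR x => by
    have h1 : (fun z => u z t) = convG fun y => m y t := funext fun z => hsol.conv t (hI ht) z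
    rw [h1, (hasDerivAt_convG (hmc t ht) hR x).deriv, hsol.conv t (hI ht) x]
    exact convG_sq_sub_convG'_sq (hmc t ht) hR x
  have hlarge : ∀ t ∈ Icc 0 τ, ∃ R, ∀ x ∉ Ioo (-R) R, m x t = 0 := fun t ht => by
    refine ⟨max |Y (-L) t| |Y L t|, fun x hx => ?_⟩
    obtain ⟨η, rfl⟩ := hYs t x
    refine hm0 t ht η (hs η fun hη => hx ⟨?_, ?_⟩)
    · exact (neg_le.1 ((neg_le_abs _).trans (le_max_left _ _))).trans_lt (hmono t hη.1)
    · exact (hmono t hη.2).trans_le ((le_abs_self _).trans (le_max_right _ _))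
  -- The velocity vanishes outside the support, so the exterior characteristics do not move.
  have hstill : ∀ η ∉ Ioo (-L) L, ∀ t ∈ Icc 0 τ, Y η t = η := by
    intro η hη t ht
    have hzero : ∀ s ∈ Icc 0 τ, u (Y η s) s ^ 2 - deriv (fun z => u z s) (Y η s) ^ 2 = 0 := by
      intro s hs'
      obtain ⟨R, hR⟩ := hlarge s hs'
      rw [hvel s hs' hR]
      rcases le_or_gt η (-L) with h | h
      · have : leftMass R Real.exp (fun y => m y s) id (Y η s) = 0 := by
          refine intervalIntegral.integral_zero_ae (Eventually.of_forall fun y hy => ?_)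
          rcases le_or_gt y (Y η s) with hy' | hy'
          · obtain ⟨ζ, rfl⟩ := hYs s y
            have hζ : ζ ≤ η := (hmono s).le_iff_le.1 hy'
            simp only [hm0 s hs' ζ (hs ζ fun h' => by linarith [h'.1]), mul_zero]
          · refine mul_eq_zero_of_right _ (hR y fun h' => ?_)
            rcases le_total (-R) (Y η s) with h1 | h1
            · rw [uIoc_of_le h1] at hy; linarith [hy.2]
            · rw [uIoc_of_ge h1] at hy; linarith [hy.2, h'.1]
        rw [this, zero_mul]
      · have hη' : L ≤ η := not_lt.1 fun h' => hη ⟨h, h'⟩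
        have : rightMass R Real.exp (fun y => m y s) id (Y η s) = 0 := by
          refine intervalIntegral.integral_zero_ae (Eventually.of_forall fun y hy => ?_)
          rcases le_or_gt (Y η s) y with hy' | hy'
          · obtain ⟨ζ, rfl⟩ := hYs s y
            have hζ : η ≤ ζ := (hmono s).le_iff_le.1 hy'
            simp only [hm0 s hs' ζ (hs ζ fun h' => by linarith [h'.2]), mul_zero]
          · refine mul_eq_zero_of_right _ (hR y fun h' => ?_)
            rcases le_total (Y η s) R with h1 | h1
            · rw [uIoc_of_le h1] at hy; linarith [hy.1]
            · rw [uIoc_of_ge h1] at hy; linarith [hy.1, h'.2]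
        rw [this, mul_zero]
    have hder : ∀ s ∈ Icc 0 τ, HasDerivWithinAt (Y η) 0 (Icc 0 τ) s := fun s hs' =>
      (hYt η s hs').congr_deriv (hzero s hs')
    rw [constant_of_has_deriv_right_zero (HasDerivWithinAt.continuousOn hder) (fun s hs' =>
      (hder s (Ico_subset_Icc_self hs')).mono_of_mem_nhdsWithin (Icc_mem_nhdsGE_of_mem hs')) t ht,
      hY0]
  have hYI : ∀ t ∈ Icc 0 τ, ∀ η ∈ Icc (-L) L, Y η t ∈ Icc (-L) L := fun t ht η hη => by
    have h1 := (hmono t).monotone hη.1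
    have h2 := (hmono t).monotone hη.2
    simp only [hstill (-L) (by simp) t ht, hstill L (by simp) t ht] at h1 h2
    exact ⟨h1, h2⟩
  have hm0L : ∀ t ∈ Icc 0 τ, ∀ x ∉ Ioo (-L) L, m x t = 0 := fun t ht x hx => by
    rw [← hstill x hx t ht]
    exact hm0 t ht x (hs x hx)
  have hYode : ∀ η ∈ Icc (-L) L, ∀ t ∈ Icc 0 τ, HasDerivWithinAt (Y η)
      (leftMass L E f (fun θ => Y θ t) η * rightMass L E f (fun θ => Y θ t) η) (Icc 0 τ) t := by
    intro η _ t ht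
    refine (hYt η t ht).congr_deriv ?_
    rw [hvel t ht (hm0L t ht), leftMass_eq_exp hE hs (hYI t ht), rightMass_eq_exp hE hs (hYI t ht),
      leftMass_changeOfVariables (Y := fun θ => Y θ t) (hmc t ht) (fun θ => hYξ θ t) (hY'c t)
        (hstill (-L) (by simp) t ht) (hmY t ht),
      rightMass_changeOfVariables (Y := fun θ => Y θ t) (hmc t ht) (fun θ => hYξ θ t) (hY'c t)
        (hstill L (by simp) t ht) (hmY t ht)]
  have heqI := lagrange_ode_unique (y := Y) (z := X) (integrable_of_eq_zero hf.continuous hs)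
    hf.continuous
    (fun θ hθ => by by_contra h; exact hθ (hs θ fun h' => h (Ioo_subset_Icc_self h'))) hE
    (fun t _ => hYc.comp (Continuous.prodMk_left t))
    (fun t _ => hX.continuous.comp (Continuous.prodMk_left t)) hYode
    (fun η _ t _ => (hX.hasDerivAt η t).hasDerivWithinAt)
    (fun η _ => by rw [hY0, hX.initial])
  have hτI : τ ∈ Icc 0 τ := ⟨hτ0, le_rfl⟩
  have heq : ∀ η, Y η τ = X η τ := fun η => by
    by_cases hη : η ∈ Icc (-L) L
    · exact heqI η hη τ hτI
    · have hη' : η ∉ Ioo (-L) L := fun h => hη (Ioo_subset_Icc_self h)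
      rw [hstill η hη' τ hτI, hX.eq_self hE hf hs hη']
  have hjac : Y' ξ τ = jac L E f X ξ τ := by
    have h1 := hYξ ξ τ
    rw [show (fun η => Y η τ) = fun η => X η τ from funext heq] at h1
    exact h1.unique (hX.hasDerivAt_label hE hf ξ τ)
  rw [← hjac, ← heq]
  exact ⟨hY'0 ξ τ, hmY τ hτI ξ⟩

end FromSolution

/-! ### Bounds along characteristics -/

section Bounds

variable {L : ℝ} {E f : ℝ → ℝ} {X : ℝ → ℝ → ℝ}

theorem IsTruncatedExp.deriv_eq_exp (hL : 0 < L) (hE : IsTruncatedExp L E) :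
    ∀ x ∈ Icc (-L) L, deriv E x = Real.exp x := fun x hx => by
  have h1 : HasDerivWithinAt E (deriv E x) (Icc (-L) L) x :=
    (hE.contDiff.differentiable (by norm_num) x).hasDerivAt.hasDerivWithinAt
  have h2 : HasDerivWithinAt E (Real.exp x) (Icc (-L) L) x :=
    (Real.hasDerivAt_exp x).hasDerivWithinAt.congr_of_mem hE.eq_exp hx
  exact (uniqueDiffOn_Icc (by linarith) x hx).eq_deriv _ h1 h2

/-- For increasing `Y` the weight `e^{Y(θ) - Y(ξ)}` is at most one on `θ ≤ ξ`. -/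
theorem exp_neg_mul_integral_le (hf : Continuous f) {g Y : ℝ → ℝ} {ξ c : ℝ} (hξ : -L ≤ ξ)
    (hY : ∀ θ ≤ ξ, Y θ ≤ Y ξ) (hg : ∀ θ ∈ Icc (-L) ξ, |g θ| ≤ c * |f θ|) :
    |Real.exp (-Y ξ) * ∫ θ in (-L)..ξ, Real.exp (Y θ) * g θ| ≤ c * ∫ θ in (-L)..ξ, |f θ| := by
  rw [← intervalIntegral.integral_const_mul, ← intervalIntegral.integral_const_mul]
  refine intervalIntegral.norm_integral_le_of_norm_le (μ := volume)
    (f := fun θ => Real.exp (-Y ξ) * (Real.exp (Y θ) * g θ)) (g := fun θ => c * |f θ|) hξ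
    (Eventually.of_forall fun θ hθ => ?_)
    ((by fun_prop : Continuous fun θ => c * |f θ|).intervalIntegrable _ _)
  rw [← mul_assoc, ← Real.exp_add, Real.norm_eq_abs, abs_mul, Real.abs_exp]
  refine (mul_le_of_le_one_left (abs_nonneg _) ?_).trans (hg θ (Ioc_subset_Icc_self hθ))
  exact Real.exp_le_one_iff.2 (by linarith [hY θ hθ.2])

theorem exp_mul_integral_le (hf : Continuous f) {g Y : ℝ → ℝ} {ξ c : ℝ} (hξ : ξ ≤ L)
    (hY : ∀ θ ≥ ξ, Y ξ ≤ Y θ) (hg : ∀ θ ∈ Icc ξ L, |g θ| ≤ c * |f θ|) :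
    |Real.exp (Y ξ) * ∫ θ in ξ..L, Real.exp (-Y θ) * g θ| ≤ c * ∫ θ in ξ..L, |f θ| := by
  rw [← intervalIntegral.integral_const_mul, ← intervalIntegral.integral_const_mul]
  refine intervalIntegral.norm_integral_le_of_norm_le (μ := volume)
    (f := fun θ => Real.exp (Y ξ) * (Real.exp (-Y θ) * g θ)) (g := fun θ => c * |f θ|) hξ
    (Eventually.of_forall fun θ hθ => ?_)
    ((by fun_prop : Continuous fun θ => c * |f θ|).intervalIntegrable _ _)
  rw [← mul_assoc, ← Real.exp_add, Real.norm_eq_abs, abs_mul, Real.abs_exp]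
  refine (mul_le_of_le_one_left (abs_nonneg _) ?_).trans (hg θ (Ioc_subset_Icc_self hθ))
  exact Real.exp_le_one_iff.2 (by linarith [hY θ hθ.1.le])

theorem integral_abs_split (hf : Continuous f) (hs : ∀ θ ∉ Ioo (-L) L, f θ = 0) (ξ : ℝ) :
    (∫ θ in (-L)..ξ, |f θ|) + ∫ θ in ξ..L, |f θ| = ∫ θ, |f θ| := by
  have hi : ∀ a b, IntervalIntegrable (fun θ => |f θ|) volume a b := fun a b =>
    hf.abs.intervalIntegrable a b
  rw [intervalIntegral.integral_add_adjacent_intervals (hi _ _) (hi _ _),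
    intervalIntegral.integral_eq_integral_of_support_subset]
  intro θ hθ
  by_contra h
  exact hθ (by simp [hs θ fun h' => h (Ioo_subset_Ioc_self h')])

namespace IsTruncatedFlow

variable (hX : IsTruncatedFlow L E f X) (hE : IsTruncatedExp L E) (hf : ContDiff ℝ 1 f)
  (hs : ∀ θ ∉ Ioo (-L) L, f θ = 0)
include hX hE hf hs

/-- Twice the initial slope of `u`. -/
theorem slope2_zero {ξ : ℝ} (hξ : ξ ∈ Icc (-L) L) :
    slope2 L E f (fun θ => X θ 0) ξ = 2 * deriv (convG f) ξ := by
  have hid : (fun θ => X θ 0) = id := funext hX.initial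
  have hI : ∀ θ ∈ Icc (-L) L, id θ ∈ Icc (-L) L := fun θ hθ => hθ
  rw [(hasDerivAt_convG hf.continuous hs ξ).deriv, hid, slope2, leftMass_eq_exp hE hs hI,
    rightMass_eq_exp hE hs hI, convG', id, hE.eq_exp ξ hξ,
    hE.eq_exp (-ξ) ⟨by linarith [hξ.2], by linarith [hξ.1]⟩]
  ring

/-- Along characteristics `2 uₓ` varies at a rate of at most `M₁³ / 2`: with
`α = ∫_{-∞}^ξ |f|` and `β = ∫_ξ^∞ |f|`, particles move at speed at most `α β ≤ M₁² / 4`. -/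
theorem abs_deriv_slope2_le (hL : 0 < L) {t : ℝ} (hJ : ∀ ξ, 0 < jac L E f X ξ t) {ξ : ℝ}
    (hξ : ξ ∈ Icc (-L) L) :
    ∃ h', HasDerivAt (fun s => slope2 L E f (fun θ => X θ s) ξ) h' t ∧
      |h'| ≤ (∫ θ, |f θ|) ^ 3 / 2 := by
  set M := ∫ θ, |f θ| with hM
  set V : ℝ → ℝ := fun θ =>
    leftMass L E f (fun θ => X θ t) θ * rightMass L E f (fun θ => X θ t) θ with hV
  have hI := hX.mem_Icc hE hf hs hJ
  have hnI : ∀ θ ∈ Icc (-L) L, -X θ t ∈ Icc (-L) L := fun θ hθ =>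
    ⟨by linarith [(hI θ hθ).2], by linarith [(hI θ hθ).1]⟩
  have hmono := (hX.strictMono hE hf hJ).monotone
  have hα0 : ∀ θ ∈ Icc (-L) L, 0 ≤ ∫ η in (-L)..θ, |f η| := fun θ hθ =>
    intervalIntegral.integral_nonneg hθ.1 fun _ _ => abs_nonneg _
  have hβ0 : ∀ θ ∈ Icc (-L) L, 0 ≤ ∫ η in θ..L, |f η| := fun θ hθ =>
    intervalIntegral.integral_nonneg hθ.2 fun _ _ => abs_nonneg _
  have ha : ∀ θ ∈ Icc (-L) L, |E (-X θ t) * leftMass L E f (fun θ => X θ t) θ|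
      ≤ ∫ η in (-L)..θ, |f η| := fun θ hθ => by
    rw [leftMass_eq_exp hE hs hI, hE.eq_exp _ (hnI θ hθ)]
    have := exp_neg_mul_integral_le (Y := fun θ => X θ t) (g := f) (c := 1) hf.continuous hθ.1
      (fun η hη => hmono hη) (fun η _ => by rw [one_mul])
    rwa [one_mul] at this
  have hb : ∀ θ ∈ Icc (-L) L, |E (X θ t) * rightMass L E f (fun θ => X θ t) θ|
      ≤ ∫ η in θ..L, |f η| := fun θ hθ => by
    rw [rightMass_eq_exp hE hs hI, hE.eq_exp _ (hI θ hθ)]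
    have := exp_mul_integral_le (Y := fun θ => X θ t) (g := f) (c := 1) hf.continuous hθ.2
      (fun η hη => hmono hη) (fun η _ => by rw [one_mul])
    rwa [one_mul] at this
  have hee : ∀ θ ∈ Icc (-L) L, E (X θ t) * E (-X θ t) = 1 := fun θ hθ => by
    rw [hE.eq_exp _ (hI θ hθ), hE.eq_exp _ (hnI θ hθ), ← Real.exp_add]; simp
  -- The speed: `α(θ) β(θ) ≤ ((α(θ) + β(θ)) / 2)² = M² / 4`.
  have hVb : ∀ θ ∈ Icc (-L) L, |V θ| ≤ M ^ 2 / 4 := fun θ hθ => by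
    have e : V θ = (E (-X θ t) * leftMass L E f (fun θ => X θ t) θ) *
        (E (X θ t) * rightMass L E f (fun θ => X θ t) θ) := by
      simp only [hV]
      linear_combination (-(leftMass L E f (fun θ => X θ t) θ *
        rightMass L E f (fun θ => X θ t) θ)) * hee θ hθ
    rw [e, abs_mul]
    refine (mul_le_mul (ha θ hθ) (hb θ hθ) (abs_nonneg _) (hα0 θ hθ)).trans ?_
    have := integral_abs_split hf.continuous hs θ
    rw [← hM] at this
    rw [← this]
    nlinarith [sq_nonneg ((∫ η in (-L)..θ, |f η|) - ∫ η in θ..L, |f η|)]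
  have hVf : ∀ θ, |V θ * f θ| ≤ M ^ 2 / 4 * |f θ| := fun θ => by
    by_cases h : θ ∈ Ioo (-L) L
    · rw [abs_mul]; gcongr; exact hVb θ (Ioo_subset_Icc_self h)
    · simp [hs θ h]
  have hat : |E (-X ξ t) * ∫ θ in (-L)..ξ, deriv E (X θ t) * V θ * f θ|
      ≤ M ^ 2 / 4 * ∫ η in (-L)..ξ, |f η| := by
    have e : ∫ θ in (-L)..ξ, deriv E (X θ t) * V θ * f θ
        = ∫ θ in (-L)..ξ, Real.exp (X θ t) * (V θ * f θ) := by
      refine intervalIntegral.integral_congr fun θ _ => ?_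
      by_cases h : θ ∈ Ioo (-L) L
      · simp only [hE.deriv_eq_exp hL _ (hI θ (Ioo_subset_Icc_self h)), mul_assoc]
      · simp [hs θ h]
    rw [e, hE.eq_exp _ (hnI ξ hξ)]
    exact exp_neg_mul_integral_le (Y := fun θ => X θ t) hf.continuous hξ.1
      (fun η hη => hmono hη) fun θ _ => hVf θ
  have hbt : |E (X ξ t) * ∫ θ in ξ..L, -(deriv E (-X θ t) * V θ * f θ)|
      ≤ M ^ 2 / 4 * ∫ η in ξ..L, |f η| := by
    have e : ∫ θ in ξ..L, -(deriv E (-X θ t) * V θ * f θ)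
        = ∫ θ in ξ..L, Real.exp (-X θ t) * (-(V θ * f θ)) := by
      refine intervalIntegral.integral_congr fun θ _ => ?_
      by_cases h : θ ∈ Ioo (-L) L
      · simp only [hE.deriv_eq_exp hL _ (hnI θ (Ioo_subset_Icc_self h))]; ring
      · simp [hs θ h]
    rw [e, hE.eq_exp _ (hI ξ hξ)]
    exact exp_mul_integral_le (Y := fun θ => X θ t) hf.continuous hξ.2
      (fun η hη => hmono hη) fun θ _ => by rw [abs_neg]; exact hVf θ
  have hdE : ∀ x, HasDerivAt E (deriv E x) x := fun x =>
    (hE.contDiff.differentiable (by norm_num) x).hasDerivAt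
  have h1 := ((hdE (X ξ t)).comp t (hX.hasDerivAt ξ t)).mul
    (hX.hasDerivAt_rightMass_time hE hf ξ t)
  have h2 := ((hdE (-X ξ t)).comp t (hX.hasDerivAt ξ t).neg).mul
    (hX.hasDerivAt_leftMass_time hE hf ξ t)
  refine ⟨_, h1.sub h2, ?_⟩
  have e1 : deriv E (X ξ t) = E (X ξ t) := by
    rw [hE.deriv_eq_exp hL _ (hI ξ hξ), hE.eq_exp _ (hI ξ hξ)]
  have e2 : deriv E (-X ξ t) = E (-X ξ t) := by
    rw [hE.deriv_eq_exp hL _ (hnI ξ hξ), hE.eq_exp _ (hnI ξ hξ)]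
  set α := ∫ η in (-L)..ξ, |f η| with hα
  set β := ∫ η in ξ..L, |f η| with hβ
  have hαβ : α + β = M := integral_abs_split hf.continuous hs ξ
  have b1 : |V ξ * (E (X ξ t) * rightMass L E f (fun θ => X θ t) ξ)| ≤ M ^ 2 / 4 * β := by
    rw [abs_mul]
    exact mul_le_mul (hVb ξ hξ) (hb ξ hξ) (abs_nonneg _) (by positivity)
  have b2 : |V ξ * (E (-X ξ t) * leftMass L E f (fun θ => X θ t) ξ)| ≤ M ^ 2 / 4 * α := by
    rw [abs_mul]
    exact mul_le_mul (hVb ξ hξ) (ha ξ hξ) (abs_nonneg _) (by positivity)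
  have hsum : M ^ 2 / 4 * α + M ^ 2 / 4 * β = M ^ 3 / 4 := by rw [← mul_add, hαβ]; ring
  rw [abs_le] at b1 b2 hat hbt ⊢
  simp only [Function.comp, e1, e2]
  change _ ≤ E (X ξ t) * V ξ * _ + E (X ξ t) * (∫ θ in ξ..L, -(deriv E (-X θ t) * V θ * f θ)) -
    (E (-X ξ t) * -V ξ * _ + E (-X ξ t) * ∫ θ in (-L)..ξ, deriv E (X θ t) * V θ * f θ) ∧
    E (X ξ t) * V ξ * _ + E (X ξ t) * (∫ θ in ξ..L, -(deriv E (-X θ t) * V θ * f θ)) -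
    (E (-X ξ t) * -V ξ * _ + E (-X ξ t) * ∫ θ in (-L)..ξ, deriv E (X θ t) * V θ * f θ) ≤ _
  constructor <;> linarith [b1.1, b1.2, b2.1, b2.2, hat.1, hat.2, hbt.1, hbt.2]

/-- Integrating `∂ₜ X_ξ = f · 2 uₓ`, where `2 uₓ` stays within `M₁³ t` of its initial value, bounds
the Jacobian by a quadratic in time. -/
theorem jac_le (hL : 0 < L) {τ : ℝ} (hτ : 0 ≤ τ)
    (hJ : ∀ t ∈ Icc 0 τ, ∀ ξ, 0 < jac L E f X ξ t) {ξ : ℝ} (hξ : ξ ∈ Icc (-L) L) :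
    jac L E f X ξ τ ≤
      1 + 2 * (f ξ * deriv (convG f) ξ) * τ + |f ξ| * (∫ θ, |f θ|) ^ 3 * τ ^ 2 / 2 := by
  set M := ∫ θ, |f θ| with hM
  have hM0 : 0 ≤ M := integral_nonneg fun _ => abs_nonneg _
  set h : ℝ → ℝ := fun s => slope2 L E f (fun θ => X θ s) ξ with hh
  have hc : Continuous h := (hX.contDiff_slope2 hE hf).continuous.comp (Continuous.prodMk_right ξ)
  have hlip : ∀ s ∈ Icc 0 τ, |h s - h 0| ≤ M ^ 3 * s := fun s hs' => by
    choose! h' hd hb using fun r (hr : r ∈ Icc 0 τ) =>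
      hX.abs_deriv_slope2_le hE hf hs hL (hJ r hr) hξ
    have := norm_image_sub_le_of_norm_deriv_right_le_segment (f := h) hc.continuousOn
      (fun r hr => (hd r (Ico_subset_Icc_self hr)).hasDerivWithinAt)
      (fun r hr => hb r (Ico_subset_Icc_self hr)) s hs'
    rw [sub_zero, Real.norm_eq_abs] at this
    refine this.trans ?_
    -- The constant `M³` is twice what the estimate gives; it is the one that enters `t*`.
    have : 0 ≤ M ^ 3 * s := mul_nonneg (by positivity) hs'.1
    linarith
  have hint : |∫ s in (0 : ℝ)..τ, (h s - h 0)| ≤ M ^ 3 * (τ ^ 2 / 2) := by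
    have h1 := intervalIntegral.norm_integral_le_of_norm_le hτ (μ := volume)
      (f := fun s => h s - h 0) (g := fun s => M ^ 3 * s)
      (Eventually.of_forall fun s hs' => hlip s (Ioc_subset_Icc_self hs'))
      ((by fun_prop : Continuous fun s : ℝ => M ^ 3 * s).intervalIntegrable _ _)
    rw [intervalIntegral.integral_const_mul, integral_id] at h1
    simpa using h1
  rw [intervalIntegral.integral_sub (hc.intervalIntegrable _ _) intervalIntegrable_const,
    intervalIntegral.integral_const, smul_eq_mul, sub_zero] at hint
  have h0 : h 0 = 2 * deriv (convG f) ξ := hX.slope2_zero hE hf hs hξ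
  have e : jac L E f X ξ τ = 1 + 2 * (f ξ * deriv (convG f) ξ) * τ +
      f ξ * ((∫ s in (0 : ℝ)..τ, h s) - τ * h 0) := by
    rw [jac, h0]; ring
  rw [e]
  have := (le_abs_self (f ξ * ((∫ s in (0 : ℝ)..τ, h s) - τ * h 0)))
  rw [abs_mul] at this
  have h2 := mul_le_mul_of_nonneg_left hint (abs_nonneg (f ξ))
  linarith

end IsTruncatedFlow

end Bounds

/-! ### The maximal time -/

section MaximalTime

variable {L : ℝ} {f : ℝ → ℝ}

theorem exists_isTruncatedExp (hL : 0 < L) : ∃ E, IsTruncatedExp L E := by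
  obtain ⟨E, h1, h2, h3, h4⟩ := exists_truncated_exp hL
  exact ⟨E, h1, h2, h3, h4⟩

/-- The essential supremum of a continuous function bounds its values. -/
theorem ofReal_abs_le_supNorm {m : ℝ → ℝ → ℝ} {t : ℝ} (hm : Continuous fun x => m x t) (x : ℝ) :
    ENNReal.ofReal |m x t| ≤ supNorm m t := by
  rw [supNorm, eLpNorm_exponent_top, ← Real.enorm_eq_ofReal_abs]
  have hae : ∀ᵐ y, ‖m y t‖ₑ ≤ eLpNormEssSup (fun x => m x t) volume := ae_le_eLpNormEssSup
  have hcl : IsClosed {y | ‖m y t‖ₑ ≤ eLpNormEssSup (fun x => m x t) volume} :=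
    isClosed_le hm.enorm continuous_const
  have := (MeasureTheory.Measure.dense_of_ae hae).closure_eq
  rw [hcl.closure_eq] at this
  exact (this ▸ mem_univ x : x ∈ {y | ‖m y t‖ₑ ≤ eLpNormEssSup (fun x => m x t) volume})

variable {E : ℝ → ℝ} {X : ℝ → ℝ → ℝ} (hX : IsTruncatedFlow L E f X) (hE : IsTruncatedExp L E)
  (hf : ContDiff ℝ 1 f) (hs : ∀ θ ∉ Ioo (-L) L, f θ = 0) (hL : 0 < L)
include hX hE hf hs hL

theorem maxTime_pos : 0 < maxTime f := by
  obtain ⟨ε, hε, h⟩ := hX.exists_jac_pos_near hE hf hs (t := 0) (fun ξ => by simp [jac])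
  rw [zero_sub, zero_add] at h
  exact (ENNReal.ofReal_pos.2 hε).trans_le
    (le_sSup ⟨_, _, hX.isClassicalSolution hE hf hs hL hε hε h⟩)

/-- If `m` stays bounded up to the maximal time `T`, the relation `m X_ξ = m₀` keeps the Jacobian
positive at `T`, hence beyond `T`, and the solution can be continued. -/
theorem limsup_supNorm_eq_top (hfin : maxTime f ≠ ⊤) {u m : ℝ → ℝ → ℝ}
    (hsol : IsClassicalSolution f (maxTime f) u m) :
    limsup (supNorm m) (𝓝[<] (maxTime f).toReal) = ⊤ := by
  have hpos := maxTime_pos hX hE hf hs hL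
  set T := (maxTime f).toReal with hT
  have hT0 : 0 < T := ENNReal.toReal_pos hpos.ne' hfin
  have hTeq : ENNReal.ofReal T = maxTime f := ENNReal.ofReal_toReal hfin
  have hI : timeInterval (maxTime f) = Ico 0 T := by rw [← hTeq, timeInterval_ofReal hT0]
  by_contra hlim
  obtain ⟨K, hK1, hK2⟩ := exists_between (lt_top_iff_ne_top.2 hlim)
  have hev : ∀ᶠ t in 𝓝[<] T, supNorm m t < K := eventually_lt_of_limsup_lt hK1
  have hev' : ∀ᶠ t in 𝓝[<] T, t ∈ Ioo 0 T := Ioo_mem_nhdsLT hT0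
  have hJT : ∀ ξ, 0 < jac L E f X ξ T := by
    intro ξ
    by_cases hξ : f ξ = 0
    · rw [jac_eq_one hξ]; exact one_pos
    have hb : ∀ᶠ t in 𝓝[<] T, |f ξ| ≤ K.toReal * jac L E f X ξ t := by
      filter_upwards [hev, hev'] with t ht ht'
      have htI : t ∈ timeInterval (maxTime f) := hI ▸ Ioo_subset_Ico_self ht'
      obtain ⟨hj, hmj⟩ := hsol.jac_pos hX hE hf hs htI ξ
      have hmc : Continuous fun x => m x t :=
        (contDiffOn_univ.1 (hsol.regular_m.contDiffOn_space t htI)).continuous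
      have h1 := (ofReal_abs_le_supNorm hmc (X ξ t)).trans ht.le
      have h2 := (ENNReal.ofReal_le_iff_le_toReal hK2.ne).1 h1
      rw [← hmj, abs_mul, abs_of_pos hj]
      gcongr
    have hc : Continuous fun t => K.toReal * jac L E f X ξ t :=
      continuous_const.mul ((hX.contDiff_jac hE hf).continuous.comp (Continuous.prodMk_right ξ))
    have h1 : |f ξ| ≤ K.toReal * jac L E f X ξ T :=
      ge_of_tendsto ((hc.tendsto T).mono_left nhdsWithin_le_nhds) hb
    exact pos_of_mul_pos_right ((abs_pos.2 hξ).trans_le h1) ENNReal.toReal_nonneg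
  obtain ⟨ε, hε, h⟩ := hX.exists_jac_pos_near hE hf hs hJT
  obtain ⟨δ, hδ, h0⟩ := hX.exists_jac_pos_near hE hf hs (t := 0) (fun ξ => by simp [jac])
  -- Negative times are included to have two-sided time derivatives at `t = 0`.
  have hall : ∀ t ∈ Ioo (-δ) (T + ε), ∀ ξ, 0 < jac L E f X ξ t := fun t ht ξ => by
    rcases lt_or_ge t 0 with h1 | h1
    · exact h0 t ⟨by linarith [ht.1], by linarith⟩ ξ
    rcases lt_or_ge t T with h2 | h2
    · exact (hsol.jac_pos hX hE hf hs (hI ▸ ⟨h1, h2⟩ : t ∈ timeInterval (maxTime f)) ξ).1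
    · exact h t ⟨by linarith, ht.2⟩ ξ
  have hle : ENNReal.ofReal (T + ε) ≤ maxTime f :=
    le_sSup ⟨_, _, hX.isClassicalSolution hE hf hs hL (by linarith) hδ hall⟩
  rw [← hTeq, ENNReal.ofReal_le_ofReal_iff hT0.le] at hle
  linarith

end MaximalTime

/-! ### Solutions of the Lagrange dynamics -/

section Lagrange

variable {L : ℝ} {f : ℝ → ℝ}

/-- For strictly increasing `Z` the velocity at a particle is a product of exponential moments. -/
theorem velocity_eq (hf : Continuous f) {Z : ℝ → ℝ → ℝ} {t : ℝ}
    (hZc : ContinuousOn (fun θ => Z θ t) (Icc (-L) L))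
    (hmono : StrictMonoOn (fun θ => Z θ t) (Icc (-L) L)) {ξ : ℝ} (hξ : ξ ∈ Icc (-L) L) :
    velocity L f Z (Z ξ t) t = leftMass L Real.exp f (fun θ => Z θ t) ξ *
      rightMass L Real.exp f (fun θ => Z θ t) ξ := by
  have hsub1 : uIcc (-L) ξ ⊆ Icc (-L) L := by
    rw [uIcc_of_le hξ.1]; exact Icc_subset_Icc_right hξ.2
  have hsub2 : uIcc ξ L ⊆ Icc (-L) L := by
    rw [uIcc_of_le hξ.2]; exact Icc_subset_Icc_left hξ.1
  have i1 : IntervalIntegrable (fun θ => Real.exp (Z θ t) * f θ) volume (-L) ξ :=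
    ((Real.continuous_exp.comp_continuousOn (hZc.mono hsub1)).mul hf.continuousOn).intervalIntegrable
  have i2 : IntervalIntegrable (fun θ => Real.exp (-Z θ t) * f θ) volume ξ L :=
    ((Real.continuous_exp.comp_continuousOn (hZc.mono hsub2).neg).mul
      hf.continuousOn).intervalIntegrable
  have hleft : ∀ θ ∈ Ioo (-L) ξ, Z θ t < Z ξ t := fun θ hθ =>
    hmono ⟨hθ.1.le, hθ.2.le.trans hξ.2⟩ hξ hθ.2
  have hright : ∀ θ ∈ Ioo ξ L, Z ξ t < Z θ t := fun θ hθ =>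
    hmono hξ ⟨hξ.1.trans hθ.1.le, hθ.2.le⟩ hθ.1
  set z := Z ξ t with hz
  -- A kernel `g` that is exponential on each side of the kink splits into two moments.
  have split : ∀ (g : ℝ → ℝ) (p q : ℝ), (∀ y < z, g (z - y) = p * Real.exp (-z) * Real.exp y) →
      (∀ y > z, g (z - y) = q * Real.exp z * Real.exp (-y)) →
      ∫ θ in (-L)..L, g (z - Z θ t) * f θ =
        p * Real.exp (-z) * leftMass L Real.exp f (fun θ => Z θ t) ξ +
        q * Real.exp z * rightMass L Real.exp f (fun θ => Z θ t) ξ := by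
    intro g p q hp hq
    have e1 : EqOn (fun θ => p * Real.exp (-z) * (Real.exp (Z θ t) * f θ))
        (fun θ => g (z - Z θ t) * f θ) (Ioo (-L) ξ) := fun θ hθ => by
      simp only [hp _ (hleft θ hθ), mul_assoc]
    have e2 : EqOn (fun θ => q * Real.exp z * (Real.exp (-Z θ t) * f θ))
        (fun θ => g (z - Z θ t) * f θ) (Ioo ξ L) := fun θ hθ => by
      simp only [hq _ (hright θ hθ), mul_assoc]
    have j1 := (i1.const_mul (p * Real.exp (-z))).congr_uIoo (by rwa [uIoo_of_le hξ.1])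
    have j2 := (i2.const_mul (q * Real.exp z)).congr_uIoo (by rwa [uIoo_of_le hξ.2])
    rw [← intervalIntegral.integral_add_adjacent_intervals j1 j2,
      ← intervalIntegral.integral_congr_Ioo_of_le hξ.1 e1,
      ← intervalIntegral.integral_congr_Ioo_of_le hξ.2 e2,
      intervalIntegral.integral_const_mul, intervalIntegral.integral_const_mul]
    rfl
  have hG := split G (1 / 2) (1 / 2)
    (fun y hy => by
      rw [G, abs_of_pos (by linarith), neg_sub, sub_eq_add_neg, Real.exp_add]; ring)
    (fun y hy => by
      rw [G, abs_of_neg (by linarith), neg_neg, sub_eq_add_neg, Real.exp_add]; ring)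
  have hG' := split G' (-1 / 2) (1 / 2)
    (fun y hy => by
      rw [G', abs_of_pos (by linarith), sign_pos (by linarith), neg_sub, sub_eq_add_neg,
        Real.exp_add, SignType.coe_one]; ring)
    (fun y hy => by
      rw [G', abs_of_neg (by linarith), sign_neg (by linarith), neg_neg, sub_eq_add_neg,
        Real.exp_add, SignType.coe_neg_one]; ring)
  have he : Real.exp z * Real.exp (-z) = 1 := by rw [← Real.exp_add]; simp
  rw [velocity, hG, hG']
  linear_combination (leftMass L Real.exp f (fun θ => Z θ t) ξ *
    rightMass L Real.exp f (fun θ => Z θ t) ξ) * he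

variable {E : ℝ → ℝ} {X Z : ℝ → ℝ → ℝ} {T : ℝ≥0∞}

/-- As long as its Jacobian is positive, a solution of the Lagrange dynamics agrees with the
truncated flow. -/
theorem IsLagrangeSolution.eq_of_deriv_pos (hL : 0 < L) (hX : IsTruncatedFlow L E f X)
    (hE : IsTruncatedExp L E) (hf : ContDiff ℝ 1 f) (hs : ∀ θ ∉ Ioo (-L) L, f θ = 0)
    (hZ : IsLagrangeSolution L f T Z) {τ : ℝ} (hτ : τ ∈ timeInterval T)
    (hpos : ∀ t ∈ Icc 0 τ, ∀ ξ ∈ Icc (-L) L,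
      0 < derivWithin (fun η => Z η t) (Icc (-L) L) ξ) :
    ∀ ξ ∈ Icc (-L) L, ∀ t ∈ Icc 0 τ, Z ξ t = X ξ t := by
  have hI := Icc_subset_timeInterval hτ
  have hT : 0 < T := zero_le.trans_lt hτ.2
  have hLL : -L ≤ L := by linarith
  have hZc : ∀ t ∈ Icc 0 τ, ContinuousOn (fun θ => Z θ t) (Icc (-L) L) := fun t ht =>
    (hZ.regular.contDiffOn_space t (hI ht)).continuousOn
  have hmono : ∀ t ∈ Icc 0 τ, StrictMonoOn (fun θ => Z θ t) (Icc (-L) L) := fun t ht => by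
    refine strictMonoOn_of_deriv_pos (convex_Icc _ _) (hZc t ht) fun ξ hξ => ?_
    rw [interior_Icc] at hξ
    have := hpos t ht ξ (Ioo_subset_Icc_self hξ)
    rwa [derivWithin_of_mem_nhds (Icc_mem_nhds hξ.1 hξ.2)] at this
  have hode : ∀ ξ ∈ Icc (-L) L, ∀ t ∈ Icc 0 τ, HasDerivWithinAt (Z ξ)
      (leftMass L Real.exp f (fun θ => Z θ t) ξ * rightMass L Real.exp f (fun θ => Z θ t) ξ)
      (Icc 0 τ) t := fun ξ hξ t ht => by
    have h1 := (((hZ.regular.contDiffOn_time ξ hξ).differentiableOn (by norm_num)) t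
      (hI ht)).hasDerivWithinAt
    rw [← velocity_eq hf.continuous (hZc t ht) (hmono t ht) hξ, ← hZ.equation ξ hξ t (hI ht)]
    exact h1.mono hI
  -- The end points do not move, since one of the moments is an integral over a point.
  have hend : ∀ ξ ∈ Icc (-L) L, (∀ t ∈ Icc 0 τ, leftMass L Real.exp f (fun θ => Z θ t) ξ *
      rightMass L Real.exp f (fun θ => Z θ t) ξ = 0) → ∀ t ∈ Icc 0 τ, Z ξ t = ξ := by
    intro ξ hξ h0 t ht
    have hder : ∀ s ∈ Icc 0 τ, HasDerivWithinAt (Z ξ) 0 (Icc 0 τ) s := fun s hs' =>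
      (hode ξ hξ s hs').congr_deriv (h0 s hs')
    rw [constant_of_has_deriv_right_zero (HasDerivWithinAt.continuousOn hder) (fun s hs' =>
      (hder s (Ico_subset_Icc_self hs')).mono_of_mem_nhdsWithin (Icc_mem_nhdsGE_of_mem hs')) t ht,
      hZ.initial hT ξ hξ]
  have hendL := hend (-L) ⟨le_rfl, hLL⟩ fun t _ => by simp [leftMass]
  have hendR := hend L ⟨hLL, le_rfl⟩ fun t _ => by simp [rightMass]
  -- Extend `Z` continuously to all labels.
  set W : ℝ → ℝ → ℝ := fun ξ t => Z (projIcc (-L) L hLL ξ) t with hW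
  have hWZ : ∀ ξ ∈ Icc (-L) L, W ξ = Z ξ := fun ξ hξ => by simp only [hW, projIcc_of_mem hLL hξ]
  have hWI : ∀ t ∈ Icc 0 τ, ∀ ξ ∈ Icc (-L) L, W ξ t ∈ Icc (-L) L := fun t ht ξ hξ => by
    have h1 := (hmono t ht).monotoneOn ⟨le_rfl, hLL⟩ hξ hξ.1
    have h2 := (hmono t ht).monotoneOn hξ ⟨hLL, le_rfl⟩ hξ.2
    simp only [hendL t ht, hendR t ht] at h1 h2
    rw [hWZ ξ hξ]
    exact ⟨h1, h2⟩
  have hWode : ∀ ξ ∈ Icc (-L) L, ∀ t ∈ Icc 0 τ, HasDerivWithinAt (W ξ)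
      (leftMass L E f (fun θ => W θ t) ξ * rightMass L E f (fun θ => W θ t) ξ)
      (Icc 0 τ) t := fun ξ hξ t ht => by
    rw [hWZ ξ hξ, leftMass_eq_exp hE hs (hWI t ht), rightMass_eq_exp hE hs (hWI t ht)]
    refine (hode ξ hξ t ht).congr_deriv ?_
    congr 1
    · refine intervalIntegral.integral_congr fun θ hθ => ?_
      rw [uIcc_of_le hξ.1] at hθ
      simp only [hWZ θ ⟨hθ.1, hθ.2.trans hξ.2⟩]
    · refine intervalIntegral.integral_congr fun θ hθ => ?_
      rw [uIcc_of_le hξ.2] at hθ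
      simp only [hWZ θ ⟨hξ.1.trans hθ.1, hθ.2⟩]
  intro ξ hξ t ht
  rw [← hWZ ξ hξ]
  exact lagrange_ode_unique (y := W) (z := X) (integrable_of_eq_zero hf.continuous hs)
    hf.continuous
    (fun θ hθ => by by_contra h; exact hθ (hs θ fun h' => h (Ioo_subset_Icc_self h'))) hE
    (fun t ht => (hZc t ht).comp_continuous (by fun_prop) fun θ => (projIcc (-L) L hLL θ).2)
    (fun t _ => hX.continuous.comp (Continuous.prodMk_left t)) hWode
    (fun η _ t _ => (hX.hasDerivAt η t).hasDerivWithinAt)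
    (fun η hη => by rw [hWZ η hη, hZ.initial hT η hη, hX.initial]) ξ hξ t ht

/-- A solution of the Lagrange dynamics agrees with the truncated flow as long as the Jacobian of
the latter is positive: at the first time at which `Z_ξ` vanished, it would still equal `X_ξ`. -/
theorem IsLagrangeSolution.eq_truncatedFlow (hL : 0 < L) (hX : IsTruncatedFlow L E f X)
    (hE : IsTruncatedExp L E) (hf : ContDiff ℝ 1 f) (hs : ∀ θ ∉ Ioo (-L) L, f θ = 0)
    (hZ : IsLagrangeSolution L f T Z) (hJ : ∀ t ∈ timeInterval T, ∀ ξ, 0 < jac L E f X ξ t)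
    {τ : ℝ} (hτ : τ ∈ timeInterval T) : ∀ ξ ∈ Icc (-L) L, Z ξ τ = X ξ τ := by
  have hI := Icc_subset_timeInterval hτ
  have hT : 0 < T := zero_le.trans_lt hτ.2
  have hLL : -L < L := by linarith
  have hud : UniqueDiffOn ℝ (Icc (-L) L) := uniqueDiffOn_Icc hLL
  set D : ℝ × ℝ → ℝ := fun p => derivWithin (fun η => Z η p.2) (Icc (-L) L) p.1 with hD
  have hDc : ContinuousOn D (Icc (-L) L ×ˢ Icc 0 τ) := by
    have := hZ.regular.continuousOn_space 1 (by norm_num)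
    simp only [iteratedDerivWithin_one] at this
    exact this.mono (prod_mono_right hI)
  have hK : IsCompact (Icc (-L) L ×ˢ Icc 0 τ) := isCompact_Icc.prod isCompact_Icc
  set S := Icc (-L) L ×ˢ Icc 0 τ ∩ D ⁻¹' Iic 0 with hS
  have hSc : IsCompact S :=
    hK.of_isClosed_subset (hDc.preimage_isClosed_of_isClosed hK.isClosed isClosed_Iic)
      inter_subset_left
  have hSe : S = ∅ := by
    by_contra hne
    obtain ⟨s, ⟨⟨ξ, s'⟩, ⟨⟨hξ, hs0⟩, hDle⟩, rfl⟩, hmin⟩ := (hSc.image continuous_snd).exists_isLeast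
      ((nonempty_iff_ne_empty.2 hne).image _)
    simp only at hs0 hmin hξ
    have hbefore : ∀ r ∈ Icc 0 s', r < s' → ∀ η ∈ Icc (-L) L, Z η r = X η r := by
      intro r hr hrs η hη
      refine hZ.eq_of_deriv_pos hL hX hE hf hs (hI ⟨hr.1, hr.2.trans hs0.2⟩) (fun t ht ζ hζ => ?_)
        η hη r ⟨hr.1, le_rfl⟩
      by_contra hneg
      have hmem : t ∈ Prod.snd '' S :=
        ⟨(ζ, t), ⟨⟨hζ, ht.1, ht.2.trans (hr.2.trans hs0.2)⟩, not_lt.1 hneg⟩, rfl⟩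
      exact absurd (hmin hmem) (not_le.2 (ht.2.trans_lt hrs))
    have hat : ∀ η ∈ Icc (-L) L, Z η s' = X η s' := by
      intro η hη
      rcases eq_or_lt_of_le hs0.1 with h | h
      · rw [← h, hZ.initial hT η hη, hX.initial]
      · have hZt : Tendsto (Z η) (𝓝[<] s') (𝓝 (Z η s')) := by
          have hc := (hZ.regular.contDiffOn_time η hη).continuousOn s' (hI hs0)
          refine hc.mono_left ?_
          rw [← nhdsWithin_Ioo_eq_nhdsLT h]
          exact nhdsWithin_mono _ fun r hr => hI ⟨hr.1.le, hr.2.le.trans hs0.2⟩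
        have hXt : Tendsto (X η) (𝓝[<] s') (𝓝 (X η s')) :=
          (hX.hasDerivAt η s').continuousAt.tendsto.mono_left nhdsWithin_le_nhds
        refine tendsto_nhds_unique (hZt.congr' ?_) hXt
        filter_upwards [Ioo_mem_nhdsLT h] with r hr
        exact hbefore r ⟨hr.1.le, hr.2.le⟩ hr.2 η hη
    have hDJ : D (ξ, s') = jac L E f X ξ s' := by
      have h1 : HasDerivWithinAt (fun η => Z η s') (jac L E f X ξ s') (Icc (-L) L) ξ :=
        (hX.hasDerivAt_label hE hf ξ s').hasDerivWithinAt.congr_of_mem hat hξ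
      exact h1.derivWithin (hud ξ hξ)
    have := hJ s' (hI hs0) ξ
    rw [← hDJ] at this
    exact absurd hDle (not_le.2 this)
  intro ξ hξ
  refine hZ.eq_of_deriv_pos hL hX hE hf hs hτ (fun t ht η hη => ?_) ξ hξ τ ⟨hτ.1, le_rfl⟩
  by_contra hneg
  have : (η, t) ∈ S := ⟨⟨hη, ht⟩, not_lt.1 hneg⟩
  rw [hSe] at this
  exact this

end Lagrange

/-! ### Blow-up -/

section BlowUp

/-- The quadratic that dominates the Jacobian vanishes at `tstar`. -/
theorem quadratic_factor {a q N : ℝ} (ha : 0 < a) (hN : 0 < N)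
    (hq : Real.sqrt (N / (2 * a)) < q) (t : ℝ) :
    1 - 2 * a * q * t + a * N * t ^ 2 / 2 =
      a * (2 / N * (q - Real.sqrt (q ^ 2 - N / (2 * a))) - t) *
        (q + Real.sqrt (q ^ 2 - N / (2 * a)) - N * t / 2) := by
  have hq2 : N / (2 * a) ≤ q ^ 2 := (Real.sqrt_le_left ((Real.sqrt_nonneg _).trans hq.le)).1 hq.le
  have hS := Real.sq_sqrt (sub_nonneg.2 hq2)
  set S := Real.sqrt (q ^ 2 - N / (2 * a)) with hSdef
  have h1 : S ^ 2 * (2 * a) = q ^ 2 * (2 * a) - N := by rw [hS]; field_simp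
  field_simp
  linear_combination 2 * h1

/-- The blow-up statement for a label `ξ₀`, with `a = |m₀(ξ₀)|` and with `q` the initial rate of
compression, `q = -uₓ` where `m₀ > 0` and `q = uₓ` where `m₀ < 0`. -/
theorem blowUp_of_compression {L : ℝ} (hL : 0 < L) {f : ℝ → ℝ} (hf : ContDiff ℝ 1 f)
    (hs : ∀ θ ∉ Ioo (-L) L, f θ = 0) {ξ₀ : ℝ} (hξ₀ : f ξ₀ ≠ 0) {q : ℝ}
    (hfq : f ξ₀ * deriv (convG f) ξ₀ = -(|f ξ₀| * q))
    {N : ℝ} (hN : N = (∫ x, |f x|) ^ 3) (hq : Real.sqrt (N / (2 * |f ξ₀|)) < q)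
    {tstar : ℝ} (ht : tstar = 2 / N * (q - Real.sqrt (q ^ 2 - N / (2 * |f ξ₀|))))
    {C : ℝ} (hC : C = q + Real.sqrt (q ^ 2 - N / (2 * |f ξ₀|))) :
    0 < maxTime f ∧ maxTime f ≤ ENNReal.ofReal tstar ∧
      ∀ u m : ℝ → ℝ → ℝ, IsClassicalSolution f (maxTime f) u m →
        limsup (supNorm m) (𝓝[<] (maxTime f).toReal) = ⊤ ∧
        (maxTime f = ENNReal.ofReal tstar →
          (∀ t ∈ timeInterval (maxTime f),
            ENNReal.ofReal (1 / (C * ((maxTime f).toReal - t))) ≤ supNorm m t) ∧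
          ∀ X : ℝ → ℝ → ℝ, IsLagrangeSolution L f (maxTime f) X →
            ∀ t ∈ timeInterval (maxTime f),
              ⨅ ξ : Ioo (-L) L, deriv (fun η => X η t) (ξ : ℝ)
                ≤ C * |f ξ₀| * ((maxTime f).toReal - t)) := by
  set a := |f ξ₀| with ha
  have ha0 : 0 < a := abs_pos.2 hξ₀
  have hfi : Integrable f := integrable_of_eq_zero hf.continuous hs
  have hN0 : 0 < N := by
    rw [hN]
    refine pow_pos ?_ 3
    exact integral_pos_of_integrable_nonneg_nonzero (x := ξ₀) hf.continuous.abs hfi.abs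
      (fun x => abs_nonneg _) ha0.ne'
  have hmem : ξ₀ ∈ Ioo (-L) L := by
    by_contra h
    exact hξ₀ (hs ξ₀ h)
  have hmem' := Ioo_subset_Icc_self hmem
  obtain ⟨E, hE⟩ := exists_isTruncatedExp hL
  obtain ⟨X, hX⟩ := exists_truncatedFlow hfi hf.continuous hE
  have hpos := maxTime_pos hX hE hf hs hL
  have hq0 : 0 < q := (Real.sqrt_nonneg _).trans_lt hq
  have hC0 : 0 < C := by rw [hC]; positivity
  have hts0 : 0 < tstar := by
    rw [ht]
    refine mul_pos (by positivity) (sub_pos.2 ?_)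
    rw [Real.sqrt_lt' hq0]
    have : 0 < N / (2 * a) := by positivity
    linarith
  -- As long as a classical solution exists, the Jacobian at the label `ξ₀` lies below the quadratic.
  have hjac : ∀ {T : ℝ≥0∞} {u m : ℝ → ℝ → ℝ}, IsClassicalSolution f T u m →
      ∀ t ∈ timeInterval T, jac L E f X ξ₀ t ≤ a * (tstar - t) * (C - N * t / 2) := by
    intro T u m hsol t htI
    have h1 := hX.jac_le hE hf hs hL htI.1
      (fun s hs' ξ => (hsol.jac_pos hX hE hf hs (Icc_subset_timeInterval htI hs') ξ).1) hmem'
    rw [hfq, ← hN, ← ha] at h1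
    rw [ht, hC, ← quadratic_factor ha0 hN0 hq]
    linarith
  have hle : maxTime f ≤ ENNReal.ofReal tstar := by
    refine sSup_le ?_
    rintro T ⟨u, m, hsol⟩
    by_contra hlt
    have htI : tstar ∈ timeInterval T := ⟨hts0.le, not_le.1 hlt⟩
    have h1 := hjac hsol tstar htI
    rw [sub_self, mul_zero, zero_mul] at h1
    exact absurd (hsol.jac_pos hX hE hf hs htI ξ₀).1 (not_lt.2 h1)
  have hfin : maxTime f ≠ ⊤ := (hle.trans_lt ENNReal.ofReal_lt_top).ne
  refine ⟨hpos, hle, fun u m hsol => ⟨limsup_supNorm_eq_top hX hE hf hs hL hfin hsol,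
    fun hTs => ?_⟩⟩
  have hTr : (maxTime f).toReal = tstar := by rw [hTs, ENNReal.toReal_ofReal hts0.le]
  have hlt : ∀ t ∈ timeInterval (maxTime f), 0 < tstar - t := fun t htI => by
    have := htI.2
    rw [hTs, ENNReal.ofReal_lt_ofReal_iff hts0] at this
    linarith
  have hjac' : ∀ t ∈ timeInterval (maxTime f), jac L E f X ξ₀ t ≤ C * a * (tstar - t) := by
    intro t htI
    refine (hjac hsol t htI).trans ?_
    have h1 : 0 ≤ a * (tstar - t) := (mul_pos ha0 (hlt t htI)).le
    have h2 : 0 ≤ N * t / 2 := by have := htI.1; positivity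
    nlinarith
  rw [hTr]
  refine ⟨fun t htI => ?_, fun Z hZ t htI => ?_⟩
  · obtain ⟨hj, hmj⟩ := hsol.jac_pos hX hE hf hs htI ξ₀
    have hmc : Continuous fun x => m x t :=
      (contDiffOn_univ.1 (hsol.regular_m.contDiffOn_space t htI)).continuous
    refine le_trans (ENNReal.ofReal_le_ofReal ?_) (ofReal_abs_le_supNorm hmc (X ξ₀ t))
    have h1 : |m (X ξ₀ t) t| * jac L E f X ξ₀ t = a := by rw [ha, ← hmj, abs_mul, abs_of_pos hj]
    have hd := hlt t htI
    rw [div_le_iff₀ (mul_pos hC0 hd)]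
    have h2 := mul_le_mul_of_nonneg_left (hjac' t htI) (abs_nonneg (m (X ξ₀ t) t))
    rw [h1] at h2
    have h3 : a * 1 ≤ a * (|m (X ξ₀ t) t| * (C * (tstar - t))) := by linarith
    exact le_of_mul_le_mul_left h3 ha0
  · have hJ : ∀ s ∈ timeInterval (maxTime f), ∀ ξ, 0 < jac L E f X ξ s := fun s hs' ξ =>
      (hsol.jac_pos hX hE hf hs hs' ξ).1
    have heq := hZ.eq_truncatedFlow hL hX hE hf hs hJ htI
    have hd : ∀ ξ ∈ Ioo (-L) L, deriv (fun η => Z η t) ξ = jac L E f X ξ t := fun ξ hξ => by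
      have h1 : (fun η => Z η t) =ᶠ[𝓝 ξ] fun η => X η t := by
        filter_upwards [Icc_mem_nhds hξ.1 hξ.2] with η hη using heq η hη
      rw [h1.deriv_eq, (hX.hasDerivAt_label hE hf ξ t).deriv]
    have hbdd : BddBelow (range fun ξ : Ioo (-L) L => deriv (fun η => Z η t) (ξ : ℝ)) := by
      refine ⟨0, ?_⟩
      rintro _ ⟨ξ, rfl⟩
      simp only [hd ξ ξ.2]
      exact (hJ t htI ξ).le
    refine (ciInf_le hbdd ⟨ξ₀, hmem⟩).trans ?_
    rw [hd ξ₀ hmem]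
    exact hjac' t htI

end BlowUp

end MCH

theorem theorem4p3 (L : ℝ) (hL : 0 < L) (m₀ : ℝ → ℝ) (hm₀ : ContDiff ℝ 1 m₀)
    (hsupp : tsupport m₀ ⊆ Set.Ioo (-L) L) (M₁ : ℝ) (hM₁ : M₁ = ∫ x, |m₀ x|) :
    -- the case of a point where `m₀` is positive
    (∀ ξ₀ ∈ Set.Icc (-L) L, 0 < m₀ ξ₀ →
      ∀ p : ℝ, p = deriv (MCH.convG m₀) ξ₀ →
      Real.sqrt (M₁ ^ 3 / (2 * m₀ ξ₀)) < -p →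
      ∀ tstar : ℝ, tstar = 2 / M₁ ^ 3 * (-p - Real.sqrt (p ^ 2 - M₁ ^ 3 / (2 * m₀ ξ₀))) →
      ∀ C : ℝ, C = -p + Real.sqrt (p ^ 2 - M₁ ^ 3 / (2 * m₀ ξ₀)) →
      0 < MCH.maxTime m₀ ∧ MCH.maxTime m₀ ≤ ENNReal.ofReal tstar ∧
      ∀ u m : ℝ → ℝ → ℝ, MCH.IsClassicalSolution m₀ (MCH.maxTime m₀) u m →
        Filter.limsup (MCH.supNorm m) (𝓝[<] (MCH.maxTime m₀).toReal) = ⊤ ∧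
        (MCH.maxTime m₀ = ENNReal.ofReal tstar →
          (∀ t ∈ MCH.timeInterval (MCH.maxTime m₀),
            ENNReal.ofReal (1 / (C * ((MCH.maxTime m₀).toReal - t))) ≤ MCH.supNorm m t) ∧
          ∀ X : ℝ → ℝ → ℝ, MCH.IsLagrangeSolution L m₀ (MCH.maxTime m₀) X →
            ∀ t ∈ MCH.timeInterval (MCH.maxTime m₀),
              ⨅ ξ : Set.Ioo (-L) L, deriv (fun η => X η t) (ξ : ℝ)
                ≤ C * m₀ ξ₀ * ((MCH.maxTime m₀).toReal - t))) ∧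
    -- the companion case of a point where `m₀` is negative
    (∀ ξ₁ ∈ Set.Icc (-L) L, m₀ ξ₁ < 0 →
      ∀ p : ℝ, p = deriv (MCH.convG m₀) ξ₁ →
      Real.sqrt (M₁ ^ 3 / (-2 * m₀ ξ₁)) < p →
      ∀ tstar : ℝ, tstar = 2 / M₁ ^ 3 * (p - Real.sqrt (p ^ 2 + M₁ ^ 3 / (2 * m₀ ξ₁))) →
      ∀ C : ℝ, C = p + Real.sqrt (p ^ 2 + M₁ ^ 3 / (2 * m₀ ξ₁)) →
      0 < MCH.maxTime m₀ ∧ MCH.maxTime m₀ ≤ ENNReal.ofReal tstar ∧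
      ∀ u m : ℝ → ℝ → ℝ, MCH.IsClassicalSolution m₀ (MCH.maxTime m₀) u m →
        Filter.limsup (MCH.supNorm m) (𝓝[<] (MCH.maxTime m₀).toReal) = ⊤ ∧
        (MCH.maxTime m₀ = ENNReal.ofReal tstar →
          (∀ t ∈ MCH.timeInterval (MCH.maxTime m₀),
            ENNReal.ofReal (1 / (C * ((MCH.maxTime m₀).toReal - t))) ≤ MCH.supNorm m t) ∧
          ∀ X : ℝ → ℝ → ℝ, MCH.IsLagrangeSolution L m₀ (MCH.maxTime m₀) X →
            ∀ t ∈ MCH.timeInterval (MCH.maxTime m₀),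
              ⨅ ξ : Set.Ioo (-L) L, deriv (fun η => X η t) (ξ : ℝ)
                ≤ C * m₀ ξ₁ * (t - (MCH.maxTime m₀).toReal))) := by
  have hs : ∀ θ ∉ Ioo (-L) L, m₀ θ = 0 := fun θ hθ =>
    image_eq_zero_of_notMem_tsupport fun h => hθ (hsupp h)
  have hN : M₁ ^ 3 = (∫ x, |m₀ x|) ^ 3 := by rw [hM₁]
  refine ⟨fun ξ₀ _ hpos p hp hlt tstar ht C hC => ?_, fun ξ₁ _ hneg p hp hlt tstar ht C hC => ?_⟩
  · have habs : |m₀ ξ₀| = m₀ ξ₀ := abs_of_pos hpos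
    have h := MCH.blowUp_of_compression hL hm₀ hs hpos.ne' (q := -p) (tstar := tstar) (C := C)
      (by rw [habs, hp]; ring) hN (by rwa [habs]) (by rw [habs, neg_sq]; exact ht)
      (by rw [habs, neg_sq]; exact hC)
    rwa [habs] at h
  · have habs : |m₀ ξ₁| = -m₀ ξ₁ := abs_of_neg hneg
    have h2 : M₁ ^ 3 / (2 * |m₀ ξ₁|) = M₁ ^ 3 / (-2 * m₀ ξ₁) := by rw [habs]; congr 1; ring
    have h3 : p ^ 2 - M₁ ^ 3 / (2 * |m₀ ξ₁|) = p ^ 2 + M₁ ^ 3 / (2 * m₀ ξ₁) := by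
      rw [habs, mul_neg, div_neg, sub_neg_eq_add]
    have h := MCH.blowUp_of_compression hL hm₀ hs hneg.ne (q := p) (tstar := tstar) (C := C)
      (by rw [habs, hp]; ring) hN (by rwa [h2]) (by rwa [h3]) (by rwa [h3])
    have e : ∀ t : ℝ, C * |m₀ ξ₁| * ((MCH.maxTime m₀).toReal - t) =
        C * m₀ ξ₁ * (t - (MCH.maxTime m₀).toReal) := fun t => by rw [habs]; ring
    simpa only [e] using h
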